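/- **Setting.** Fix a set $\mathcal C_T$ of type-level constants, a set $\mathcal F_T$ of type-level function symbols and a set $\mathcal F_o$ of object-level function symbols. Terms are $$K ::= \mathsf{Type}\mid (x:U)\to K,\qquad T,U ::= \lambda x{:}U.\,T\mid (x:U)\to T\mid U\,t\mid D\mid F,\qquad t,u ::= x\mid \lambda x{:}U.\,t\mid t\,u\mid f$$ (kinds, types, objects; $D\in\mathcal C_T$, $F\in\mathcal F_T$, $f\in\mathcal F_o$). A function $\tau$ gives a kind to each symbol of $\mathcal C_T\cup\mathcal F_T$ and a type to each symbol of $\mathcal F_o$; the arity of a symbol is the number of leading arrows of its type or kind. A *constructor* is an $f\in\mathcal F_o$ with $\tau(f)=(x_1:T_1)\to\dots\to(x_n:T_n)\to U$ where $U$ and all $T_i$ are of the form $D\,u_1\dots u_{m}$ with $D\in\mathcal C_T$ of arity $m$. *Patterns* are $p::=x\mid c\,p_1\dots p_{n}$ with $c$ a constructor of arity $n$. Let $\mathcal R$ be a set of rules $f\,p_1\dots p_n\to r$ with $f\in\mathcal F_T\cup\mathcal F_o$ of arity $n$, patterns $p_i$, and $r$ a $\beta$-normal term of the same level (type or object) as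 $f$; assume that only finitely many symbols head a rule (constructors may be among them). Let $\to$ be the union of $\beta$-reduction and of the smallest rewrite relation containing $\mathcal R$, and $\leftrightarrow^*$ the equivalence it generates. Typing $\Gamma\vdash t:A$ is that of LF (a symbol $f$ having type $\tau(f)$ if $\tau(f)$ is itself well formed in the empty context), with the conversion rule: from $\Gamma\vdash t:A$, $\Gamma\vdash A:s$, $\Gamma\vdash B:s$ and $A\leftrightarrow^*B$, with $s\in\{\mathsf{Type},\mathsf{Kind}\}$, infer $\Gamma\vdash t:B$. **Calls and size-change termination.** Let $f\,\bar p>_{call}g\,\bar t$ if there is a rule $f\,\bar p\to r$ in $\mathcal R$ such that $g\in\mathcal F_T\cup\mathcal F_o$ and $g\,\bar t$ is a subterm of $r$ with $|\bar t|$ the arity of $g$. Let $\lhd$ be the smallest transitive relation with $t_i\lhd c\,t_1\dots t_n$ for $c$ a constructor. The call $f\,\bar p>_{call}g\,\bar t$ is an edge from $f$ to $g$ labelled with the matrix $(a_{i,j})$ where $a_{i,j}=-1$ if $t_j\lhd p_i$, $a_{i,j}=0$ if $t_j=p_i$, and $a_{i,j}=\infty$ otherwise. Edges compose by the matrix product over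 $\{-1,0,\infty\}$ whose sum is the minimum and whose product is addition truncated below at $-1$. $\mathcal R$ satisfies *size-change termination* if in the transitive closure of this graph every edge from a node to itself has a $-1$ on the diagonal of its matrix. **Computability closure.** For a left-hand side $f\,\bar p$, let $CC_{>_{call}}(f\,\bar p)$ be the smallest set of typed terms $\Gamma\vdash_c t:A$ ($\Gamma$ declaring the variables bound above $t$) such that: a variable of $\bar p$ has any type expected at one of its occurrences, that is, $T_i[\bar p]$ if it is the $i$-th argument of $f$ or of a constructor with argument types $T_i$; it is closed under the LF rules for bound variables, type-level constants, products, abstractions and applications and under conversion modulo $\leftrightarrow^*$; and, if $f\,\bar p>_{call}g\,\bar u$, $\tau(g)=(\bar y:\bar U)\to V$ is well formed, and $\Gamma\vdash_c u_i:U_i[\bar u]$ for all $i$, then $\Gamma\vdash_c g\,\bar u:V[\bar u]$. This is the only rule that introduces function symbols. $\mathcal R$ satisfies $CC_{>_{call}}$ if for every rule $f\,\bar p\to r$, with $\tau(f)=(\bar x:\bar T)\to U$, one has $\vdash_c r:U[\bar p]$ in $CC_{>_{call}}(f\,\bar p)$. **Proposition.** Suppose that ${\to}={\to_\beta\cup\to_{\mathcal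 R}}$ is confluent and preserves typing. If $\mathcal R$ satisfies $CC_{>_{call}}$ and size-change termination, then $\to$ is strongly normalizing on every term (object, type or kind) that is typable in the $\lambda\Pi$-calculus modulo $\leftrightarrow^*$. -/

import Mathlib

universe u v

namespace LambdaPi

/-! ### Terms

Variables are de Bruijn indices and stand for objects only.  The signature is given by a type `C` of
type-level constants and a family `F` of function symbols: `F .ty` are the type-level ones and
`F .obj` the object-level ones. -/

/-- The two levels of terms that can head an application. -/
inductive Lvl
  | obj
  | ty

/-- Object-level terms (`l = .obj`) and type-level terms (`l = .ty`). `lam U t` and `pi U T` bind one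
variable in `t`, `T`. -/
inductive Term (C : Type u) (F : Lvl → Type v) : Lvl → Type (max u v)
  | var (n : ℕ) : Term C F .obj
  | fn {l : Lvl} (f : F l) : Term C F l
  | con (D : C) : Term C F .ty
  | lam {l : Lvl} (U : Term C F .ty) (t : Term C F l) : Term C F l
  | app {l : Lvl} (t : Term C F l) (u : Term C F .obj) : Term C F l
  | pi (U T : Term C F .ty) : Term C F .ty

/-- Kind-level terms `Type` and `(x : U) → K`. -/
inductive Kd (C : Type u) (F : Lvl → Type v) : Type (max u v)
  | type : Kd C F
  | pi (U : Term C F .ty) (K : Kd C F) : Kd C F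

abbrev Obj (C : Type u) (F : Lvl → Type v) := Term C F .obj
abbrev Ty (C : Type u) (F : Lvl → Type v) := Term C F .ty

/-- Function symbols of both levels. -/
abbrev Sym (F : Lvl → Type v) := Σ l : Lvl, F l

variable {C : Type u} {F : Lvl → Type v}

/-! ### Renaming and substitution -/

/-- Lifting of a renaming under a binder. -/
def liftRen (ξ : ℕ → ℕ) : ℕ → ℕ
  | 0 => 0
  | n + 1 => ξ n + 1

def Term.rename : {l : Lvl} → (ℕ → ℕ) → Term C F l → Term C F l
  | _, ξ, .var n => .var (ξ n)
  | _, _, .fn f => .fn f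
  | _, _, .con D => .con D
  | _, ξ, .lam U t => .lam (U.rename ξ) (t.rename (liftRen ξ))
  | _, ξ, .app t u => .app (t.rename ξ) (u.rename ξ)
  | _, ξ, .pi U T => .pi (U.rename ξ) (T.rename (liftRen ξ))

/-- Weakening by `k` variables. -/
def Term.shift {l : Lvl} (k : ℕ) (t : Term C F l) : Term C F l := t.rename (· + k)

/-- Lifting of a substitution under a binder. -/
def liftSub (σ : ℕ → Obj C F) : ℕ → Obj C F
  | 0 => .var 0
  | n + 1 => (σ n).shift 1

/-- Simultaneous capture-avoiding substitution. -/
def Term.subst : {l : Lvl} → (ℕ → Obj C F) → Term C F l → Term C F l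
  | _, σ, .var n => σ n
  | _, _, .fn f => .fn f
  | _, _, .con D => .con D
  | _, σ, .lam U t => .lam (U.subst σ) (t.subst (liftSub σ))
  | _, σ, .app t u => .app (t.subst σ) (u.subst σ)
  | _, σ, .pi U T => .pi (U.subst σ) (T.subst (liftSub σ))

def Kd.subst (σ : ℕ → Obj C F) : Kd C F → Kd C F
  | .type => .type
  | .pi U K => .pi (U.subst σ) (K.subst (liftSub σ))

/-- The substitution that replaces the last bound variable by `u`. -/
def single (u : Obj C F) : ℕ → Obj C F
  | 0 => u
  | n + 1 => .var n

def Term.inst {l : Lvl} (t : Term C F l) (u : Obj C F) : Term C F l := t.subst (single u)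
def Kd.inst (K : Kd C F) (u : Obj C F) : Kd C F := K.subst (single u)

/-- `apps t [u₁, …, uₙ] = t u₁ … uₙ`. -/
def apps {l : Lvl} : Term C F l → List (Obj C F) → Term C F l
  | t, [] => t
  | t, u :: us => apps (.app t u) us

/-! ### Signatures, arities, constructors, patterns -/

/-- The function `τ`: a kind for every type-level symbol, a type for every object-level symbol. -/
structure Sig (C : Type u) (F : Lvl → Type v) where
  con : C → Kd C F
  tyFn : F .ty → Kd C F
  objFn : F .obj → Ty C F

/-- The number of leading arrows of a type. -/
def Term.arity : {l : Lvl} → Term C F l → ℕ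
  | _, .pi _ T => T.arity + 1
  | _, _ => 0

/-- The number of leading arrows of a kind. -/
def Kd.arity : Kd C F → ℕ
  | .type => 0
  | .pi _ K => K.arity + 1

/-- The arity of a function symbol. -/
def Sig.arity (S : Sig C F) : Sym F → ℕ
  | ⟨.ty, f⟩ => (S.tyFn f).arity
  | ⟨.obj, f⟩ => (S.objFn f).arity

/-- `T` is `D u₁ … uₙ` with `D` a type-level constant of arity `n`. -/
def Sig.IsData (S : Sig C F) (T : Ty C F) : Prop :=
  ∃ (D : C) (us : List (Obj C F)), us.length = (S.con D).arity ∧ T = apps (.con D) us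

/-- `T` is `(x₁ : T₁) → … → (xₙ : Tₙ) → U` with all the `Tᵢ` and `U` of the form `D u₁ … uₙ`. -/
inductive Sig.IsCtorType (S : Sig C F) : Ty C F → Prop
  | data {U : Ty C F} : S.IsData U → S.IsCtorType U
  | arrow {T U : Ty C F} : S.IsData T → S.IsCtorType U → S.IsCtorType (.pi T U)

/-- The set of constructors. A constructor may well head rewrite rules. -/
def Sig.IsCtor (S : Sig C F) (c : F .obj) : Prop := S.IsCtorType (S.objFn c)

inductive Sig.IsPattern (S : Sig C F) : Obj C F → Prop
  | var (n : ℕ) : S.IsPattern (.var n)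
  | ctor (c : F .obj) (ps : List (Obj C F)) : S.IsCtor c → ps.length = S.arity ⟨.obj, c⟩ →
      (∀ p ∈ ps, S.IsPattern p) → S.IsPattern (apps (.fn c) ps)

/-! ### Rewriting -/

/-- A set of rules: `R f [p₁, …, pₙ] r` means that `f p₁ … pₙ → r` is a rule. The two sides have the
same level. The pattern variables of the rule are its de Bruijn indices. -/
abbrev Rules (C : Type u) (F : Lvl → Type v) :=
  ∀ ⦃l : Lvl⦄, F l → List (Obj C F) → Term C F l → Prop

/-- The union of `β`-reduction and of the smallest rewrite relation containing `R`. -/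
inductive Step (R : Rules C F) : {l : Lvl} → Term C F l → Term C F l → Prop
  | beta {l : Lvl} (U : Ty C F) (t : Term C F l) (u : Obj C F) :
      Step R (.app (.lam U t) u) (t.inst u)
  | rule {l : Lvl} {f : F l} {ps : List (Obj C F)} {r : Term C F l} (σ : ℕ → Obj C F) :
      R f ps r → Step R (apps (.fn f) (ps.map (Term.subst σ))) (r.subst σ)
  | lamDom {l : Lvl} {U U' : Ty C F} (t : Term C F l) :
      Step R U U' → Step R (.lam U t) (.lam U' t)
  | lamBody {l : Lvl} (U : Ty C F) {t t' : Term C F l} :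
      Step R t t' → Step R (.lam U t) (.lam U t')
  | appFun {l : Lvl} {t t' : Term C F l} (u : Obj C F) :
      Step R t t' → Step R (.app t u) (.app t' u)
  | appArg {l : Lvl} (t : Term C F l) {u u' : Obj C F} :
      Step R u u' → Step R (.app t u) (.app t u')
  | piDom {U U' : Ty C F} (T : Ty C F) : Step R U U' → Step R (.pi U T) (.pi U' T)
  | piCod (U : Ty C F) {T T' : Ty C F} : Step R T T' → Step R (.pi U T) (.pi U T')

/-- The same relation on kinds. -/
inductive KStep (R : Rules C F) : Kd C F → Kd C F → Prop
  | piDom {U U' : Ty C F} (K : Kd C F) : Step R U U' → KStep R (.pi U K) (.pi U' K)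
  | piCod (U : Ty C F) {K K' : Kd C F} : KStep R K K' → KStep R (.pi U K) (.pi U K')

/-- `β`-normal terms: no step with the empty set of rules. -/
def BetaNormal {l : Lvl} (t : Term C F l) : Prop :=
  ∀ t' : Term C F l, ¬ Step (fun _ _ _ _ => False) t t'

/-- Rules are of the form `f p₁ … pₙ → r` with `n` the arity of `f`, patterns `pᵢ` and `r`
`β`-normal. -/
def Sig.IsRewriteSystem (S : Sig C F) (R : Rules C F) : Prop :=
  ∀ (l : Lvl) (f : F l) (ps : List (Obj C F)) (r : Term C F l), R f ps r →
    ps.length = S.arity ⟨l, f⟩ ∧ (∀ p ∈ ps, S.IsPattern p) ∧ BetaNormal r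

/-- The symbols that head a rule. -/
def Defined (R : Rules C F) : Set (Sym F) := {f | ∃ ps r, R f.2 ps r}

/-- Confluence of a relation. -/
def IsConfluent {α : Type*} (r : α → α → Prop) : Prop :=
  ∀ a b c, Relation.ReflTransGen r a b → Relation.ReflTransGen r a c →
    ∃ d, Relation.ReflTransGen r b d ∧ Relation.ReflTransGen r c d

/-- Strong normalization of `a`: every reduction sequence from `a` is finite. -/
def Terminates {α : Type*} (r : α → α → Prop) (a : α) : Prop := Acc (fun x y => r y x) a

/-! ### Typing in the `λΠ`-calculus modulo `β` and `R` -/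

/-- Judgments; in a context the most recently bound variable comes first. -/
inductive Judg (C : Type u) (F : Lvl → Type v) : Type (max u v)
  /-- `Γ` is well formed -/
  | ctx (Γ : List (Ty C F))
  /-- `Γ ⊢ K : Kind` -/
  | kind (Γ : List (Ty C F)) (K : Kd C F)
  /-- `Γ ⊢ T : K` -/
  | ty (Γ : List (Ty C F)) (T : Ty C F) (K : Kd C F)
  /-- `Γ ⊢ t : A` -/
  | obj (Γ : List (Ty C F)) (t : Obj C F) (A : Ty C F)

/-- Derivable judgments. -/
inductive Deriv (S : Sig C F) (R : Rules C F) : Judg C F → Prop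
  | ctxNil : Deriv S R (.ctx [])
  | ctxCons {Γ : List (Ty C F)} {A : Ty C F} :
      Deriv S R (.ctx Γ) → Deriv S R (.ty Γ A .type) → Deriv S R (.ctx (A :: Γ))
  | kindType {Γ : List (Ty C F)} : Deriv S R (.ctx Γ) → Deriv S R (.kind Γ .type)
  | kindPi {Γ : List (Ty C F)} {U : Ty C F} {K : Kd C F} :
      Deriv S R (.ty Γ U .type) → Deriv S R (.kind (U :: Γ) K) → Deriv S R (.kind Γ (.pi U K))
  | tyCon {Γ : List (Ty C F)} (D : C) :
      Deriv S R (.ctx Γ) → Deriv S R (.kind [] (S.con D)) → Deriv S R (.ty Γ (.con D) (S.con D))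
  | tyFn {Γ : List (Ty C F)} (f : F .ty) :
      Deriv S R (.ctx Γ) → Deriv S R (.kind [] (S.tyFn f)) →
      Deriv S R (.ty Γ (.fn f) (S.tyFn f))
  | tyPi {Γ : List (Ty C F)} {U T : Ty C F} :
      Deriv S R (.ty Γ U .type) → Deriv S R (.ty (U :: Γ) T .type) →
      Deriv S R (.ty Γ (.pi U T) .type)
  | tyLam {Γ : List (Ty C F)} {U T : Ty C F} {K : Kd C F} :
      Deriv S R (.ty Γ U .type) → Deriv S R (.ty (U :: Γ) T K) →
      Deriv S R (.ty Γ (.lam U T) (.pi U K))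
  | tyApp {Γ : List (Ty C F)} {T U : Ty C F} {K : Kd C F} {u : Obj C F} :
      Deriv S R (.ty Γ T (.pi U K)) → Deriv S R (.obj Γ u U) →
      Deriv S R (.ty Γ (.app T u) (K.inst u))
  | tyConv {Γ : List (Ty C F)} {T : Ty C F} {K K' : Kd C F} :
      Deriv S R (.ty Γ T K) → Deriv S R (.kind Γ K) → Deriv S R (.kind Γ K') →
      Relation.EqvGen (KStep R) K K' → Deriv S R (.ty Γ T K')
  | objVar {Γ : List (Ty C F)} {n : ℕ} {A : Ty C F} :
      Deriv S R (.ctx Γ) → Γ[n]? = some A → Deriv S R (.obj Γ (.var n) (A.shift (n + 1)))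
  | objFn {Γ : List (Ty C F)} (f : F .obj) :
      Deriv S R (.ctx Γ) → Deriv S R (.ty [] (S.objFn f) .type) →
      Deriv S R (.obj Γ (.fn f) (S.objFn f))
  | objLam {Γ : List (Ty C F)} {U B : Ty C F} {t : Obj C F} :
      Deriv S R (.ty Γ U .type) → Deriv S R (.obj (U :: Γ) t B) →
      Deriv S R (.obj Γ (.lam U t) (.pi U B))
  | objApp {Γ : List (Ty C F)} {U B : Ty C F} {t u : Obj C F} :
      Deriv S R (.obj Γ t (.pi U B)) → Deriv S R (.obj Γ u U) →
      Deriv S R (.obj Γ (.app t u) (B.inst u))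
  | objConv {Γ : List (Ty C F)} {t : Obj C F} {A B : Ty C F} :
      Deriv S R (.obj Γ t A) → Deriv S R (.ty Γ A .type) → Deriv S R (.ty Γ B .type) →
      Relation.EqvGen (Step R) A B → Deriv S R (.obj Γ t B)

/-- Reduction preserves typing. -/
def PreservesTyping (S : Sig C F) (R : Rules C F) : Prop :=
  (∀ Γ t t' A, Deriv S R (.obj Γ t A) → Step R t t' → Deriv S R (.obj Γ t' A)) ∧
  (∀ Γ T T' K, Deriv S R (.ty Γ T K) → Step R T T' → Deriv S R (.ty Γ T' K)) ∧
  (∀ Γ K K', Deriv S R (.kind Γ K) → KStep R K K' → Deriv S R (.kind Γ K'))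

/-! ### Formal calls and size-change termination -/

/-- `SubtermAt s k t`: `s` occurs in `t` below exactly `k` binders of `t`. -/
inductive SubtermAt : {l l' : Lvl} → Term C F l → ℕ → Term C F l' → Prop
  | refl {l : Lvl} (t : Term C F l) : SubtermAt t 0 t
  | lamDom {l l' : Lvl} {s : Term C F l} {k : ℕ} {U : Ty C F} (t : Term C F l') :
      SubtermAt s k U → SubtermAt s k (.lam U t)
  | lamBody {l l' : Lvl} {s : Term C F l} {k : ℕ} (U : Ty C F) {t : Term C F l'} :
      SubtermAt s k t → SubtermAt s (k + 1) (.lam U t)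
  | appFun {l l' : Lvl} {s : Term C F l} {k : ℕ} {t : Term C F l'} (u : Obj C F) :
      SubtermAt s k t → SubtermAt s k (.app t u)
  | appArg {l l' : Lvl} {s : Term C F l} {k : ℕ} (t : Term C F l') {u : Obj C F} :
      SubtermAt s k u → SubtermAt s k (.app t u)
  | piDom {l : Lvl} {s : Term C F l} {k : ℕ} {U : Ty C F} (T : Ty C F) :
      SubtermAt s k U → SubtermAt s k (.pi U T)
  | piCod {l : Lvl} {s : Term C F l} {k : ℕ} (U : Ty C F) {T : Ty C F} :
      SubtermAt s k T → SubtermAt s (k + 1) (.pi U T)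

/-- The formal call relation `f ps >_call g ts`, for an occurrence of `g ts` below `k` binders of
the right-hand side: in `ts` the pattern variable `n` is the index `n + k`. -/
def Call (S : Sig C F) (R : Rules C F) (f : Sym F) (ps : List (Obj C F)) (k : ℕ) (g : Sym F)
    (ts : List (Obj C F)) : Prop :=
  ∃ r : Term C F f.1, R f.2 ps r ∧ ts.length = S.arity g ∧ SubtermAt (apps (.fn g.2) ts) k r

/-- The strict constructor subterm relation. -/
def CtorSub (S : Sig C F) : Obj C F → Obj C F → Prop :=
  Relation.TransGen fun t s => ∃ c ts, S.IsCtor c ∧ t ∈ ts ∧ s = apps (.fn c) ts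

/-- Matrices with entries `-1`, `0` and `∞ = ⊤`. -/
abbrev SizeMatrix (m n : ℕ) := Fin m → Fin n → WithTop ℤ

open Classical in
/-- The matrix of the call `f ps >_call g ts` at depth `k`. -/
noncomputable def callMatrix (S : Sig C F) (m n : ℕ) (ps : List (Obj C F)) (k : ℕ)
    (ts : List (Obj C F)) : SizeMatrix m n := fun i j =>
  if ∃ p t, ps[i.1]? = some p ∧ ts[j.1]? = some t ∧ CtorSub S t (p.shift k) then -1
  else if ∃ p t, ps[i.1]? = some p ∧ ts[j.1]? = some t ∧ t = p.shift k then 0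
  else ⊤

/-- Matrix product over the semiring `{-1, 0, ∞}` whose sum is the minimum (`∞`, the absence of
information, being neutral) and whose product is addition truncated at `-1`. -/
def SizeMatrix.comp {m n p : ℕ} (A : SizeMatrix m n) (B : SizeMatrix n p) : SizeMatrix m p :=
  fun i j => Finset.univ.inf fun k => max (-1) (A i k + B k j)

/-- The edges of the transitive closure of the call graph. -/
inductive CallPath (S : Sig C F) (R : Rules C F) :
    (f g : Sym F) → SizeMatrix (S.arity f) (S.arity g) → Prop
  | edge {f g : Sym F} {ps ts : List (Obj C F)} {k : ℕ} : Call S R f ps k g ts →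
      CallPath S R f g (callMatrix S (S.arity f) (S.arity g) ps k ts)
  | comp {f g h : Sym F} {A : SizeMatrix (S.arity f) (S.arity g)}
      {B : SizeMatrix (S.arity g) (S.arity h)} :
      CallPath S R f g A → CallPath S R g h B → CallPath S R f h (A.comp B)

/-- The size-change termination principle. -/
def SizeChangeTerminating (S : Sig C F) (R : Rules C F) : Prop :=
  ∀ (f : Sym F) (M : SizeMatrix (S.arity f) (S.arity f)), CallPath S R f f M → ∃ i, M i i = -1

/-! ### Computability closure -/

/-- `AccTy S T ps x A`: when the patterns `ps` are the first arguments of a symbol of type `T`, the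
variable `x` occurs in `ps` at a position where an object of type `A` is expected. -/
inductive AccTy (S : Sig C F) : Ty C F → List (Obj C F) → ℕ → Ty C F → Prop
  | here {A B : Ty C F} {x : ℕ} {ps : List (Obj C F)} : AccTy S (.pi A B) (.var x :: ps) x A
  | inside {A B T : Ty C F} {x : ℕ} {c : F .obj} {qs ps : List (Obj C F)} :
      S.IsCtor c → qs.length = S.arity ⟨.obj, c⟩ → AccTy S (S.objFn c) qs x T →
      AccTy S (.pi A B) (apps (.fn c) qs :: ps) x T
  | there {A B T : Ty C F} {x : ℕ} {p : Obj C F} {ps : List (Obj C F)} :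
      AccTy S (B.inst p) ps x T → AccTy S (.pi A B) (p :: ps) x T

/-- The same for the arguments of a type-level symbol of kind `K`. -/
inductive AccKd (S : Sig C F) : Kd C F → List (Obj C F) → ℕ → Ty C F → Prop
  | here {A : Ty C F} {K : Kd C F} {x : ℕ} {ps : List (Obj C F)} :
      AccKd S (.pi A K) (.var x :: ps) x A
  | inside {A T : Ty C F} {K : Kd C F} {x : ℕ} {c : F .obj} {qs ps : List (Obj C F)} :
      S.IsCtor c → qs.length = S.arity ⟨.obj, c⟩ → AccTy S (S.objFn c) qs x T →
      AccKd S (.pi A K) (apps (.fn c) qs :: ps) x T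
  | there {A T : Ty C F} {K : Kd C F} {x : ℕ} {p : Obj C F} {ps : List (Obj C F)} :
      AccKd S (K.inst p) ps x T → AccKd S (.pi A K) (p :: ps) x T

/-- The variable `x` of the left-hand side `f ps` has type `A`. -/
def Sig.LhsVar (S : Sig C F) : Sym F → List (Obj C F) → ℕ → Ty C F → Prop
  | ⟨.ty, f⟩, ps, x, A => AccKd S (S.tyFn f) ps x A
  | ⟨.obj, f⟩, ps, x, A => AccTy S (S.objFn f) ps x A

/-- Judgments of the computability closure. The context `Γ` holds the variables bound on the way from
the root of the right-hand side; the variables of the left-hand side come after those of `Γ`. -/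
inductive CJudg (C : Type u) (F : Lvl → Type v) : Type (max u v)
  /-- `t` belongs to the closure with type `A` -/
  | obj (Γ : List (Ty C F)) (t : Obj C F) (A : Ty C F)
  /-- `T` belongs to the closure with kind `K` -/
  | ty (Γ : List (Ty C F)) (T : Ty C F) (K : Kd C F)
  /-- the `us` belong to the closure and are arguments for the type `A`, leaving the type `B` -/
  | tyArgs (Γ : List (Ty C F)) (A : Ty C F) (us : List (Obj C F)) (B : Ty C F)
  /-- the `us` belong to the closure and are arguments for the kind `K`, leaving the kind `K'` -/
  | kdArgs (Γ : List (Ty C F)) (K : Kd C F) (us : List (Obj C F)) (K' : Kd C F)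

/-- The computability closure of the left-hand side `f ps` with respect to the formal call relation.
It consists of the typing rules, except that a function symbol `g` can only be introduced by a call
`f ps >_call g us` whose arguments belong to the closure. Conversion is unrestricted, which only
makes the closure larger than with a premise that the new type is well formed. -/
inductive CC (S : Sig C F) (R : Rules C F) (f : Sym F) (ps : List (Obj C F)) : CJudg C F → Prop
  | lhsVar {Γ : List (Ty C F)} {x : ℕ} {A : Ty C F} : S.LhsVar f ps x A →
      CC S R f ps (.obj Γ (.var (x + Γ.length)) (A.shift Γ.length))
  | boundVar {Γ : List (Ty C F)} {n : ℕ} {A : Ty C F} : Γ[n]? = some A →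
      CC S R f ps (.obj Γ (.var n) (A.shift (n + 1)))
  | objCall {Γ : List (Ty C F)} {g : F .obj} {us : List (Obj C F)} {B : Ty C F} :
      Call S R f ps Γ.length ⟨.obj, g⟩ us → Deriv S R (.ty [] (S.objFn g) .type) →
      CC S R f ps (.tyArgs Γ (S.objFn g) us B) → CC S R f ps (.obj Γ (apps (.fn g) us) B)
  | tyCall {Γ : List (Ty C F)} {g : F .ty} {us : List (Obj C F)} {K : Kd C F} :
      Call S R f ps Γ.length ⟨.ty, g⟩ us → Deriv S R (.kind [] (S.tyFn g)) →
      CC S R f ps (.kdArgs Γ (S.tyFn g) us K) → CC S R f ps (.ty Γ (apps (.fn g) us) K)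
  | tyArgsNil {Γ : List (Ty C F)} {A : Ty C F} : CC S R f ps (.tyArgs Γ A [] A)
  | tyArgsCons {Γ : List (Ty C F)} {A B B' : Ty C F} {u : Obj C F} {us : List (Obj C F)} :
      CC S R f ps (.obj Γ u A) → CC S R f ps (.tyArgs Γ (B.inst u) us B') →
      CC S R f ps (.tyArgs Γ (.pi A B) (u :: us) B')
  | kdArgsNil {Γ : List (Ty C F)} {K : Kd C F} : CC S R f ps (.kdArgs Γ K [] K)
  | kdArgsCons {Γ : List (Ty C F)} {A : Ty C F} {K K' : Kd C F} {u : Obj C F}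
      {us : List (Obj C F)} :
      CC S R f ps (.obj Γ u A) → CC S R f ps (.kdArgs Γ (K.inst u) us K') →
      CC S R f ps (.kdArgs Γ (.pi A K) (u :: us) K')
  | tyCon {Γ : List (Ty C F)} (D : C) :
      Deriv S R (.kind [] (S.con D)) → CC S R f ps (.ty Γ (.con D) (S.con D))
  | tyPi {Γ : List (Ty C F)} {U T : Ty C F} :
      CC S R f ps (.ty Γ U .type) → CC S R f ps (.ty (U :: Γ) T .type) →
      CC S R f ps (.ty Γ (.pi U T) .type)
  | tyLam {Γ : List (Ty C F)} {U T : Ty C F} {K : Kd C F} :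
      CC S R f ps (.ty Γ U .type) → CC S R f ps (.ty (U :: Γ) T K) →
      CC S R f ps (.ty Γ (.lam U T) (.pi U K))
  | tyApp {Γ : List (Ty C F)} {T U : Ty C F} {K : Kd C F} {u : Obj C F} :
      CC S R f ps (.ty Γ T (.pi U K)) → CC S R f ps (.obj Γ u U) →
      CC S R f ps (.ty Γ (.app T u) (K.inst u))
  | tyConv {Γ : List (Ty C F)} {T : Ty C F} {K K' : Kd C F} :
      CC S R f ps (.ty Γ T K) → Relation.EqvGen (KStep R) K K' → CC S R f ps (.ty Γ T K')
  | objLam {Γ : List (Ty C F)} {U B : Ty C F} {t : Obj C F} :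
      CC S R f ps (.ty Γ U .type) → CC S R f ps (.obj (U :: Γ) t B) →
      CC S R f ps (.obj Γ (.lam U t) (.pi U B))
  | objApp {Γ : List (Ty C F)} {U B : Ty C F} {t u : Obj C F} :
      CC S R f ps (.obj Γ t (.pi U B)) → CC S R f ps (.obj Γ u U) →
      CC S R f ps (.obj Γ (.app t u) (B.inst u))
  | objConv {Γ : List (Ty C F)} {t : Obj C F} {A B : Ty C F} :
      CC S R f ps (.obj Γ t A) → Relation.EqvGen (Step R) A B → CC S R f ps (.obj Γ t B)

/-- The result type of a symbol of type `T` applied to the given arguments. -/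
def resultTy : Ty C F → List (Obj C F) → Ty C F
  | T, [] => T
  | .pi _ B, p :: ps => resultTy (B.inst p) ps
  | T, _ :: _ => T

/-- Every right-hand side belongs to the computability closure of its left-hand side, with the type
of that left-hand side (which is `Type` when the head is a type-level symbol). -/
def SatisfiesCC (S : Sig C F) (R : Rules C F) : Prop :=
  (∀ (f : F .obj) ps r, R f ps r → CC S R ⟨.obj, f⟩ ps (.obj [] r (resultTy (S.objFn f) ps))) ∧
  (∀ (f : F .ty) ps r, R f ps r → CC S R ⟨.ty, f⟩ ps (.ty [] r .type))

end LambdaPi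

open LambdaPi

/-! The proof uses reducibility candidates. `Interp` interprets a type by a set of objects: a type
convertible to a product by a dependent function space, a type convertible to no product by all
strongly normalizing objects. Confluence makes products injective up to conversion, so
interpretations are unique and invariant under conversion (`Interp.unique`), and they are candidates
(`Interp.isCand`). Computability at a kind is defined by recursion on the kind (`KComp`).

The obstacle is a circularity: interpreting the type of a symbol requires the symbols in that type
to be computable, while computability of a symbol refers to the interpretation of its type. Moreover
conversion is unrestricted in the computability closure, so the types met there need not be
interpretable. `Comp` breaks the circle by being defined at every type. It agrees with the
interpretation when there is one; otherwise it constrains the reducts that are abstractions and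
forbids those that are partial applications, just enough for abstraction and application to remain
sound (`Comp.lam`, `Comp.app`). This suffices because the closure introduces symbols only with all
their arguments.

Hence an instance of a right-hand side is computable as soon as its pattern variables and its calls
are (`CC.valid`). Variables below a constructor have data types, where computability is strong
normalization. Calls are treated by well-founded induction (`acc_callRel`): the order generated by
reduction and constructor arguments is well founded on strongly normalizing objects, so arguments
have ordinal ranks. An infinite chain of calls visits some symbol infinitely often, and tuples of
ordinals are well-quasi-ordered, so between two of these visits no rank drops, whereas size-change
termination makes some rank drop. This gives `callComp`.

Finally `Deriv.valid` shows by induction on derivations that types of typable objects do have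
interpretations and that the objects belong to them. Candidates contain the variables, so the
identity substitution may be used. -/

namespace LambdaPi

variable {C : Type u} {F : Lvl → Type v}

/-! ### Substitution calculus -/

/-- The substitution that maps `0` to `u` and `n + 1` to `σ n`. -/
def scons (u : Obj C F) (σ : ℕ → Obj C F) : ℕ → Obj C F
  | 0 => u
  | n + 1 => σ n

theorem single_eq_scons (u : Obj C F) : single u = scons u .var := by
  funext n; cases n <;> rfl

theorem liftSub_var_comp (ξ : ℕ → ℕ) :
    liftSub (fun n => (.var (ξ n) : Obj C F)) = fun n => .var (liftRen ξ n) := by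
  funext n; cases n <;> rfl

theorem rename_eq_subst {l : Lvl} (t : Term C F l) (ξ : ℕ → ℕ) :
    t.rename ξ = t.subst (fun n => .var (ξ n)) := by
  induction t generalizing ξ with
  | var n => rfl
  | fn f => rfl
  | con D => rfl
  | lam U t ihU iht => simp only [Term.rename, Term.subst, ihU, iht, liftSub_var_comp]
  | app t u iht ihu => simp only [Term.rename, Term.subst, iht, ihu]
  | pi U T ihU ihT => simp only [Term.rename, Term.subst, ihU, ihT, liftSub_var_comp]

theorem subst_rename {l : Lvl} (t : Term C F l) (ξ : ℕ → ℕ) (σ : ℕ → Obj C F) :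
    (t.rename ξ).subst σ = t.subst (fun n => σ (ξ n)) := by
  have key : ∀ (ξ : ℕ → ℕ) (σ : ℕ → Obj C F),
      (fun n => liftSub σ (liftRen ξ n)) = liftSub (fun n => σ (ξ n)) := by
    intro ξ σ; funext n; cases n <;> rfl
  induction t generalizing ξ σ with
  | var n => rfl
  | fn f => rfl
  | con D => rfl
  | lam U t ihU iht => simp only [Term.rename, Term.subst, ihU, iht, key]
  | app t u iht ihu => simp only [Term.rename, Term.subst, iht, ihu]
  | pi U T ihU ihT => simp only [Term.rename, Term.subst, ihU, ihT, key]

theorem rename_subst {l : Lvl} (t : Term C F l) (σ : ℕ → Obj C F) (ξ : ℕ → ℕ) :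
    (t.subst σ).rename ξ = t.subst (fun n => (σ n).rename ξ) := by
  have key : ∀ (σ : ℕ → Obj C F) (ξ : ℕ → ℕ),
      (fun n => (liftSub σ n).rename (liftRen ξ)) = liftSub (fun n => (σ n).rename ξ) := by
    intro σ ξ; funext n
    cases n with
    | zero => rfl
    | succ n => simp only [liftSub, Term.shift, rename_eq_subst _ (liftRen ξ), subst_rename,
        rename_eq_subst ((σ n).rename ξ), liftRen]
  induction t generalizing σ ξ with
  | var n => rfl
  | fn f => rfl
  | con D => rfl
  | lam U t ihU iht => simp only [Term.rename, Term.subst, ihU, iht, key]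
  | app t u iht ihu => simp only [Term.rename, Term.subst, iht, ihu]
  | pi U T ihU ihT => simp only [Term.rename, Term.subst, ihU, ihT, key]

theorem liftSub_comp (σ ρ : ℕ → Obj C F) :
    (fun n => (liftSub σ n).subst (liftSub ρ)) = liftSub (fun n => (σ n).subst ρ) := by
  funext n
  cases n with
  | zero => rfl
  | succ n => simp only [liftSub, Term.shift, subst_rename, rename_subst]

theorem subst_subst {l : Lvl} (t : Term C F l) (σ ρ : ℕ → Obj C F) :
    (t.subst σ).subst ρ = t.subst (fun n => (σ n).subst ρ) := by
  induction t generalizing σ ρ with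
  | var n => rfl
  | fn f => rfl
  | con D => rfl
  | lam U t ihU iht => simp only [Term.subst, ihU, iht, liftSub_comp]
  | app t u iht ihu => simp only [Term.subst, iht, ihu]
  | pi U T ihU ihT => simp only [Term.subst, ihU, ihT, liftSub_comp]

theorem liftSub_var : liftSub (.var : ℕ → Obj C F) = .var := by
  funext n; cases n <;> rfl

theorem subst_var {l : Lvl} (t : Term C F l) : t.subst .var = t := by
  induction t with
  | var n => rfl
  | fn f => rfl
  | con D => rfl
  | lam U t ihU iht => simp only [Term.subst, ihU, iht, liftSub_var]
  | app t u iht ihu => simp only [Term.subst, iht, ihu]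
  | pi U T ihU ihT => simp only [Term.subst, ihU, ihT, liftSub_var]

theorem scons_comp (u : Obj C F) (σ ρ : ℕ → Obj C F) :
    (fun n => (scons u σ n).subst ρ) = scons (u.subst ρ) (fun n => (σ n).subst ρ) := by
  funext n; cases n <;> rfl

theorem inst_subst {l : Lvl} (t : Term C F l) (u : Obj C F) (σ : ℕ → Obj C F) :
    (t.inst u).subst σ = t.subst (scons (u.subst σ) σ) := by
  simp only [Term.inst, single_eq_scons, subst_subst, scons_comp, Term.subst]

theorem subst_liftSub_inst {l : Lvl} (t : Term C F l) (u : Obj C F) (σ : ℕ → Obj C F) :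
    (t.subst (liftSub σ)).inst u = t.subst (scons u σ) := by
  simp only [Term.inst, single_eq_scons, subst_subst]
  congr 1
  funext n
  cases n with
  | zero => rfl
  | succ n => simp only [liftSub, Term.shift, subst_rename, scons]; exact subst_var _

theorem inst_subst_comm {l : Lvl} (t : Term C F l) (u : Obj C F) (σ : ℕ → Obj C F) :
    (t.inst u).subst σ = (t.subst (liftSub σ)).inst (u.subst σ) := by
  rw [inst_subst, subst_liftSub_inst]

theorem shift_subst {l : Lvl} (t : Term C F l) (k : ℕ) (σ : ℕ → Obj C F) :
    (t.shift k).subst σ = t.subst (fun n => σ (n + k)) := subst_rename _ _ _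

theorem apps_append {l : Lvl} (t : Term C F l) (us vs : List (Obj C F)) :
    apps t (us ++ vs) = apps (apps t us) vs := by
  induction us generalizing t with
  | nil => rfl
  | cons u us ih => exact ih _

theorem apps_concat {l : Lvl} (t : Term C F l) (us : List (Obj C F)) (u : Obj C F) :
    apps t (us ++ [u]) = .app (apps t us) u := apps_append _ _ _

theorem apps_subst {l : Lvl} (t : Term C F l) (us : List (Obj C F)) (σ : ℕ → Obj C F) :
    (apps t us).subst σ = apps (t.subst σ) (us.map (Term.subst σ)) := by
  induction us generalizing t with
  | nil => rfl
  | cons u us ih => exact ih _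

theorem arity_subst {l : Lvl} (T : Term C F l) (hl : l = .ty) (σ : ℕ → Obj C F) :
    (T.subst σ).arity = T.arity := by
  induction T generalizing σ with
  | var n => cases hl
  | fn f => rfl
  | con D => rfl
  | lam U t => rfl
  | app t u => rfl
  | pi U T _ ihT => simp only [Term.subst, Term.arity, ihT rfl]

theorem arity_inst (T : Ty C F) (u : Obj C F) : (T.inst u).arity = T.arity :=
  arity_subst T rfl _

theorem kd_arity_subst (K : Kd C F) (σ : ℕ → Obj C F) : (K.subst σ).arity = K.arity := by
  induction K generalizing σ with
  | type => rfl
  | pi U K ih => simp only [Kd.subst, Kd.arity, ih]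

theorem eq_pi_of_arity_pos (T : Ty C F) (h : 0 < T.arity) : ∃ U V, T = .pi U V := by
  cases T with
  | pi U V => exact ⟨U, V, rfl⟩
  | _ => simp [Term.arity] at h

/-! ### Closed terms -/

/-- All free variables of `t` are below `n`. -/
def Term.Below : {l : Lvl} → ℕ → Term C F l → Prop
  | _, n, .var m => m < n
  | _, _, .fn _ => True
  | _, _, .con _ => True
  | _, n, .lam U t => U.Below n ∧ t.Below (n + 1)
  | _, n, .app t u => t.Below n ∧ u.Below n
  | _, n, .pi U T => U.Below n ∧ T.Below (n + 1)

/-- All free variables of `K` are below `n`. -/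
def Kd.Below : ℕ → Kd C F → Prop
  | _, .type => True
  | n, .pi U K => U.Below n ∧ K.Below (n + 1)

theorem liftSub_eq_var_of_lt {n : ℕ} {σ : ℕ → Obj C F} (h : ∀ m < n, σ m = .var m) :
    ∀ m < n + 1, liftSub σ m = .var m := by
  intro m hm
  cases m with
  | zero => rfl
  | succ m => simp only [liftSub, h m (by omega)]; rfl

theorem Term.Below.subst_eq {l : Lvl} {t : Term C F l} {n : ℕ} (ht : t.Below n)
    {σ : ℕ → Obj C F} (h : ∀ m < n, σ m = .var m) : t.subst σ = t := by
  induction t generalizing n σ with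
  | var m => exact h m ht
  | fn f => rfl
  | con D => rfl
  | lam U t ihU iht =>
    simp only [Term.subst, ihU ht.1 h, iht ht.2 (liftSub_eq_var_of_lt h)]
  | app t u iht ihu => simp only [Term.subst, iht ht.1 h, ihu ht.2 h]
  | pi U T ihU ihT =>
    simp only [Term.subst, ihU ht.1 h, ihT ht.2 (liftSub_eq_var_of_lt h)]

theorem Kd.Below.subst_eq {K : Kd C F} {n : ℕ} (hK : K.Below n)
    {σ : ℕ → Obj C F} (h : ∀ m < n, σ m = .var m) : K.subst σ = K := by
  induction K generalizing n σ with
  | type => rfl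
  | pi U K ih =>
    simp only [Kd.subst, Term.Below.subst_eq hK.1 h, ih hK.2 (liftSub_eq_var_of_lt h)]

/-- The subject of a judgment only uses variables of the context. -/
def Judg.Scoped : Judg C F → Prop
  | .ctx _ => True
  | .kind Γ K => K.Below Γ.length
  | .ty Γ T _ => T.Below Γ.length
  | .obj Γ t _ => t.Below Γ.length

/-- This is what makes the well-formed declared types and kinds of symbols closed, so that
substitutions disappear from them. -/
theorem Deriv.scoped {S : Sig C F} {R : Rules C F} {J : Judg C F} (h : Deriv S R J) :
    J.Scoped := by
  induction h with
  | ctxNil | ctxCons | kindType | tyCon | tyFn | objFn => trivial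
  | objVar _ h => exact (List.getElem?_eq_some_iff.1 h).1
  | kindPi _ _ h₁ h₂ | tyPi _ _ h₁ h₂ | tyLam _ _ h₁ h₂ | objLam _ _ h₁ h₂ => exact ⟨h₁, h₂⟩
  | tyApp _ _ h₁ h₂ | objApp _ _ h₁ h₂ => exact ⟨h₁, h₂⟩
  | tyConv _ _ _ _ h | objConv _ _ _ _ h => exact h

theorem Deriv.subst_eq_of_ty {S : Sig C F} {R : Rules C F} {T : Ty C F} {K : Kd C F}
    (h : Deriv S R (.ty [] T K)) (σ : ℕ → Obj C F) : T.subst σ = T :=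
  Term.Below.subst_eq h.scoped (fun _ hm => absurd hm (Nat.not_lt_zero _))

theorem Deriv.subst_eq_of_kind {S : Sig C F} {R : Rules C F} {K : Kd C F}
    (h : Deriv S R (.kind [] K)) (σ : ℕ → Obj C F) : K.subst σ = K :=
  Kd.Below.subst_eq h.scoped (fun _ hm => absurd hm (Nat.not_lt_zero _))

/-! ### Reduction and conversion -/

/-- Reduction in any number of steps. -/
abbrev Red (R : Rules C F) {l : Lvl} : Term C F l → Term C F l → Prop :=
  Relation.ReflTransGen (Step R)

/-- Convertibility. -/
abbrev Conv (R : Rules C F) {l : Lvl} : Term C F l → Term C F l → Prop :=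
  Relation.EqvGen (Step R)

/-- Strong normalization. -/
abbrev SN (R : Rules C F) {l : Lvl} (t : Term C F l) : Prop := Terminates (Step R) t

variable {S : Sig C F} {R : Rules C F}

theorem Step.subst {l : Lvl} {t t' : Term C F l} (h : Step R t t') (σ : ℕ → Obj C F) :
    Step R (t.subst σ) (t'.subst σ) := by
  induction h generalizing σ with
  | beta U t u => rw [inst_subst_comm]; exact .beta _ _ _
  | @rule l f ps r ρ hr =>
    rw [apps_subst, subst_subst, List.map_map]
    have : (Term.subst σ ∘ Term.subst ρ : Obj C F → Obj C F)
        = Term.subst (fun n => (ρ n).subst σ) := by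
      funext p; exact subst_subst _ _ _
    rw [this]
    exact .rule _ hr
  | lamDom t _ ih => exact .lamDom _ (ih σ)
  | lamBody U _ ih => exact .lamBody _ (ih _)
  | appFun u _ ih => exact .appFun _ (ih σ)
  | appArg t _ ih => exact .appArg _ (ih σ)
  | piDom T _ ih => exact .piDom _ (ih σ)
  | piCod U _ ih => exact .piCod _ (ih _)

theorem Red.map {l l' : Lvl} {t t' : Term C F l} (φ : Term C F l → Term C F l')
    (hφ : ∀ t t', Step R t t' → Step R (φ t) (φ t')) (h : Red R t t') : Red R (φ t) (φ t') := by
  induction h with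
  | refl => exact .refl
  | tail _ h ih => exact ih.tail (hφ _ _ h)

theorem Red.subst {l : Lvl} {t t' : Term C F l} (h : Red R t t') (σ : ℕ → Obj C F) :
    Red R (t.subst σ) (t'.subst σ) :=
  h.map (Term.subst σ) (fun _ _ h => h.subst σ)

theorem Red.lam {l : Lvl} {U U' : Ty C F} {t t' : Term C F l} (hU : Red R U U')
    (ht : Red R t t') : Red R (.lam U t) (.lam U' t') :=
  (hU.map (fun U => Term.lam U t) (fun _ _ h => .lamDom _ h)).trans
    (ht.map (fun t => Term.lam U' t) (fun _ _ h => .lamBody _ h))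

theorem Red.app {l : Lvl} {t t' : Term C F l} {u u' : Obj C F} (ht : Red R t t')
    (hu : Red R u u') : Red R (.app t u) (.app t' u') :=
  (ht.map (fun t => Term.app t u) (fun _ _ h => .appFun _ h)).trans
    (hu.map (fun u => Term.app t' u) (fun _ _ h => .appArg _ h))

theorem Red.pi {U U' T T' : Ty C F} (hU : Red R U U') (hT : Red R T T') :
    Red R (.pi U T) (.pi U' T') :=
  (hU.map (fun U => Term.pi U T) (fun _ _ h => .piDom _ h)).trans
    (hT.map (fun T => Term.pi U' T) (fun _ _ h => .piCod _ h))

theorem red_liftSub {σ σ' : ℕ → Obj C F} (h : ∀ n, Red R (σ n) (σ' n)) (n : ℕ) :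
    Red R (liftSub σ n) (liftSub σ' n) := by
  cases n with
  | zero => exact .refl
  | succ n => simp only [liftSub, Term.shift, rename_eq_subst]; exact (h n).subst _

theorem red_subst_of_red {l : Lvl} (t : Term C F l) {σ σ' : ℕ → Obj C F}
    (h : ∀ n, Red R (σ n) (σ' n)) : Red R (t.subst σ) (t.subst σ') := by
  induction t generalizing σ σ' with
  | var n => exact h n
  | fn f => exact .refl
  | con D => exact .refl
  | lam U t ihU iht => exact (ihU h).lam (iht (red_liftSub h))
  | app t u iht ihu => exact (iht h).app (ihu h)
  | pi U T ihU ihT => exact (ihU h).pi (ihT (red_liftSub h))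

theorem red_scons {u u' : Obj C F} (hu : Red R u u') {σ σ' : ℕ → Obj C F}
    (h : ∀ n, Red R (σ n) (σ' n)) (n : ℕ) : Red R (scons u σ n) (scons u' σ' n) := by
  cases n with
  | zero => exact hu
  | succ n => exact h n

theorem red_inst_of_red {l : Lvl} (t : Term C F l) {u u' : Obj C F} (h : Red R u u') :
    Red R (t.inst u) (t.inst u') := by
  simp only [Term.inst, single_eq_scons]
  exact red_subst_of_red _ (red_scons h fun _ => .refl)

theorem Red.conv {l : Lvl} {t t' : Term C F l} (h : Red R t t') : Conv R t t' := by
  induction h with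
  | refl => exact .refl _
  | tail _ h ih => exact ih.trans _ _ _ (.rel _ _ h)

theorem Conv.subst {l : Lvl} {t t' : Term C F l} (h : Conv R t t') (σ : ℕ → Obj C F) :
    Conv R (t.subst σ) (t'.subst σ) := by
  induction h with
  | rel _ _ h => exact .rel _ _ (h.subst σ)
  | refl => exact .refl _
  | symm _ _ _ ih => exact ih.symm
  | trans _ _ _ _ _ ih₁ ih₂ => exact ih₁.trans _ _ _ ih₂

theorem Conv.exists_red (hconf : ∀ l : Lvl, IsConfluent (Step R (l := l))) {l : Lvl}
    {t t' : Term C F l} (h : Conv R t t') : ∃ s, Red R t s ∧ Red R t' s := by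
  induction h with
  | rel x y h => exact ⟨y, .single h, .refl⟩
  | refl x => exact ⟨x, .refl, .refl⟩
  | symm _ _ _ ih => obtain ⟨s, h₁, h₂⟩ := ih; exact ⟨s, h₂, h₁⟩
  | trans _ _ _ _ _ ih₁ ih₂ =>
    obtain ⟨s₁, h₁, h₂⟩ := ih₁
    obtain ⟨s₂, h₃, h₄⟩ := ih₂
    obtain ⟨s, h₅, h₆⟩ := hconf _ _ _ _ h₂ h₃
    exact ⟨s, h₁.trans h₅, h₄.trans h₆⟩

/-! ### Inversion of steps -/

theorem apps_fn_cases {l : Lvl} (f : F l) (us : List (Obj C F)) :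
    (us = [] ∧ apps (.fn f) us = (.fn f : Term C F l)) ∨
      ∃ vs v, us = vs ++ [v] ∧ apps (.fn f : Term C F l) us = .app (apps (.fn f) vs) v := by
  rcases List.eq_nil_or_concat us with rfl | ⟨vs, v, rfl⟩
  · exact .inl ⟨rfl, rfl⟩
  · exact .inr ⟨vs, v, List.concat_eq_append, by rw [List.concat_eq_append, apps_concat]⟩

theorem apps_fn_inj {l : Lvl} {f g : F l} {us vs : List (Obj C F)}
    (h : apps (.fn f : Term C F l) us = apps (.fn g) vs) : f = g ∧ us = vs := by
  -- The outermost application of `apps` carries the last argument, hence the induction from the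
  -- right.
  induction us using List.reverseRecOn generalizing vs with
  | nil =>
    rcases apps_fn_cases g vs with ⟨rfl, h'⟩ | ⟨ws, w, rfl, h'⟩
    · exact ⟨by simpa [apps] using h, rfl⟩
    · rw [h'] at h; cases h
  | append_singleton us u ih =>
    rw [apps_concat] at h
    rcases apps_fn_cases g vs with ⟨rfl, h'⟩ | ⟨ws, w, rfl, h'⟩
    · rw [h'] at h; cases h
    · rw [h'] at h
      simp only [Term.app.injEq] at h
      obtain ⟨rfl, rfl⟩ := ih h.1
      exact ⟨rfl, by rw [h.2]⟩

theorem step_app_inv {l : Lvl} {t : Term C F l} {u : Obj C F} {s : Term C F l}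
    (h : Step R (.app t u) s) :
    (∃ U b, t = .lam U b ∧ s = b.inst u) ∨
    (∃ (f : F l) (ps : List (Obj C F)) (r : Term C F l) (σ : ℕ → Obj C F),
      R f ps r ∧ .app t u = apps (.fn f) (ps.map (Term.subst σ)) ∧ s = r.subst σ) ∨
    (∃ t', Step R t t' ∧ s = .app t' u) ∨ ∃ u', Step R u u' ∧ s = .app t u' := by
  generalize hx : Term.app t u = x at h
  cases h with
  | beta U b v => cases hx; exact .inl ⟨_, _, rfl, rfl⟩
  | rule σ hr => exact .inr (.inl ⟨_, _, _, σ, hr, rfl, rfl⟩)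
  | appFun _ h => cases hx; exact .inr (.inr (.inl ⟨_, h, rfl⟩))
  | appArg _ h => cases hx; exact .inr (.inr (.inr ⟨_, h, rfl⟩))
  | lamDom | lamBody | piDom | piCod => cases hx

theorem step_lam_inv {l : Lvl} {U : Ty C F} {t s : Term C F l} (h : Step R (.lam U t) s) :
    (∃ U', Step R U U' ∧ s = .lam U' t) ∨ ∃ t', Step R t t' ∧ s = .lam U t' := by
  generalize hx : Term.lam U t = x at h
  cases h with
  | @rule _ f ps r σ hr =>
    rcases apps_fn_cases f (ps.map (Term.subst σ)) with ⟨_, h'⟩ | ⟨_, _, _, h'⟩ <;>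
      rw [h'] at hx <;> cases hx
  | lamDom _ h => cases hx; exact .inl ⟨_, h, rfl⟩
  | lamBody _ h => cases hx; exact .inr ⟨_, h, rfl⟩
  | beta | appFun | appArg | piDom | piCod => cases hx

theorem step_pi_inv {U T s : Ty C F} (h : Step R (.pi U T) s) :
    (∃ U', Step R U U' ∧ s = .pi U' T) ∨ ∃ T', Step R T T' ∧ s = .pi U T' := by
  generalize hx : Term.pi U T = x at h
  cases h with
  | @rule _ f ps r σ hr =>
    rcases apps_fn_cases f (ps.map (Term.subst σ)) with ⟨_, h'⟩ | ⟨_, _, _, h'⟩ <;>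
      rw [h'] at hx <;> cases hx
  | piDom _ h => cases hx; exact .inl ⟨_, h, rfl⟩
  | piCod _ h => cases hx; exact .inr ⟨_, h, rfl⟩
  | beta | appFun | appArg | lamDom | lamBody => cases hx

theorem not_step_var {n : ℕ} {s : Obj C F} (h : Step R (.var n) s) : False := by
  generalize hx : Term.var n = x at h
  cases h with
  | @rule _ f ps r σ hr =>
    rcases apps_fn_cases f (ps.map (Term.subst σ)) with ⟨_, h'⟩ | ⟨_, _, _, h'⟩ <;>
      rw [h'] at hx <;> cases hx
  | _ => cases hx

theorem not_step_con {D : C} {s : Ty C F} (h : Step R (.con D) s) : False := by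
  generalize hx : Term.con D = x at h
  cases h with
  | @rule _ f ps r σ hr =>
    rcases apps_fn_cases f (ps.map (Term.subst σ)) with ⟨_, h'⟩ | ⟨_, _, _, h'⟩ <;>
      rw [h'] at hx <;> cases hx
  | _ => cases hx

theorem red_lam_inv {l : Lvl} {U : Ty C F} {t s : Term C F l} (h : Red R (.lam U t) s) :
    ∃ U' t', s = .lam U' t' ∧ Red R U U' ∧ Red R t t' := by
  induction h with
  | refl => exact ⟨U, t, rfl, .refl, .refl⟩
  | tail _ h ih =>
    obtain ⟨U', t', rfl, hU, ht⟩ := ih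
    rcases step_lam_inv h with ⟨_, h', rfl⟩ | ⟨_, h', rfl⟩
    · exact ⟨_, _, rfl, hU.tail h', ht⟩
    · exact ⟨_, _, rfl, hU, ht.tail h'⟩

theorem red_pi_inv {U T s : Ty C F} (h : Red R (.pi U T) s) :
    ∃ U' T', s = .pi U' T' ∧ Red R U U' ∧ Red R T T' := by
  induction h with
  | refl => exact ⟨U, T, rfl, .refl, .refl⟩
  | tail _ h ih =>
    obtain ⟨U', t', rfl, hU, ht⟩ := ih
    rcases step_pi_inv h with ⟨_, h', rfl⟩ | ⟨_, h', rfl⟩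
    · exact ⟨_, _, rfl, hU.tail h', ht⟩
    · exact ⟨_, _, rfl, hU, ht.tail h'⟩

/-- No redex is a product, so products reduce componentwise; the common reduct given by confluence
compares the components. -/
theorem Conv.pi_inj (hconf : ∀ l : Lvl, IsConfluent (Step R (l := l))) {U V U' V' : Ty C F}
    (h : Conv R (.pi U V) (.pi U' V')) : Conv R U U' ∧ Conv R V V' := by
  obtain ⟨s, h₁, h₂⟩ := h.exists_red hconf
  obtain ⟨U₁, V₁, rfl, hU, hV⟩ := red_pi_inv h₁
  obtain ⟨U₂, V₂, e, hU', hV'⟩ := red_pi_inv h₂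
  cases e
  exact ⟨hU.conv.trans _ _ _ hU'.conv.symm, hV.conv.trans _ _ _ hV'.conv.symm⟩

/-! ### Types headed by a constant -/

/-- The head of `t` is a type-level constant. -/
def Term.ConHeaded : {l : Lvl} → Term C F l → Prop
  | _, .con _ => True
  | _, .app t _ => t.ConHeaded
  | _, _ => False

theorem conHeaded_apps {l : Lvl} {t : Term C F l} (h : t.ConHeaded) (us : List (Obj C F)) :
    (apps t us).ConHeaded := by
  induction us generalizing t with
  | nil => exact h
  | cons u us ih => exact ih h

theorem not_conHeaded_apps_fn {l : Lvl} (f : F l) (us : List (Obj C F)) :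
    ¬ (apps (.fn f : Term C F l) us).ConHeaded := by
  induction us using List.reverseRecOn with
  | nil => exact id
  | append_singleton us u ih => rw [apps_concat]; exact ih

theorem Term.ConHeaded.step {l : Lvl} {t s : Term C F l} (ht : t.ConHeaded) (h : Step R t s) :
    s.ConHeaded := by
  induction h with
  | beta | lamDom | lamBody | piDom | piCod => exact ht.elim
  | rule => exact (not_conHeaded_apps_fn _ _ ht).elim
  | appFun u _ ih => exact ih ht
  | appArg t _ _ => exact ht

theorem Term.ConHeaded.red {l : Lvl} {t s : Term C F l} (ht : t.ConHeaded) (h : Red R t s) :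
    s.ConHeaded := by
  induction h with
  | refl => exact ht
  | tail _ h ih => exact ih.step h

/-- A head constant survives every reduction, since rules are headed by function symbols, and
products reduce only to products; a common reduct would be both. -/
theorem Term.ConHeaded.not_conv_pi (hconf : ∀ l : Lvl, IsConfluent (Step R (l := l)))
    {T U V : Ty C F} (hT : T.ConHeaded) : ¬ Conv R T (.pi U V) := by
  intro h
  obtain ⟨s, h₁, h₂⟩ := h.exists_red hconf
  obtain ⟨U₁, V₁, rfl, _, _⟩ := red_pi_inv h₂
  exact hT.red h₁

theorem Sig.IsData.conHeaded {T : Ty C F} (h : S.IsData T) : T.ConHeaded := by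
  obtain ⟨D, us, _, rfl⟩ := h
  exact conHeaded_apps (by simp only [Term.ConHeaded]) us

theorem Sig.IsData.subst {T : Ty C F} (h : S.IsData T) (σ : ℕ → Obj C F) :
    S.IsData (T.subst σ) := by
  obtain ⟨D, us, hl, rfl⟩ := h
  exact ⟨D, us.map (Term.subst σ), by simpa using hl, apps_subst _ _ _⟩

theorem Sig.IsCtorType.subst {T : Ty C F} (h : S.IsCtorType T) (σ : ℕ → Obj C F) :
    S.IsCtorType (T.subst σ) := by
  induction h generalizing σ with
  | data h => exact .data (h.subst σ)
  | arrow h _ ih => exact .arrow (h.subst σ) (ih _)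

/-! ### Strongly normalizing terms -/

theorem SN.step {l : Lvl} {t t' : Term C F l} (h : SN R t) (hs : Step R t t') : SN R t' :=
  h.inv hs

theorem SN.of_map {l l' : Lvl} (φ : Term C F l → Term C F l')
    (hφ : ∀ t t', Step R t t' → Step R (φ t) (φ t')) {t : Term C F l} (h : SN R (φ t)) :
    SN R t := by
  generalize hx : φ t = x at h
  induction h generalizing t with
  | intro x _ ih =>
    subst hx
    exact ⟨_, fun t' ht => ih _ (hφ _ _ ht) rfl⟩

/-- Steps are stable under substitution. This recovers normalization of the body of a binder from a
single instance of it. -/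
theorem SN.of_subst {l : Lvl} {t : Term C F l} {σ : ℕ → Obj C F} (h : SN R (t.subst σ)) :
    SN R t := SN.of_map _ (fun _ _ h => h.subst σ) h

theorem SN.of_app_left {l : Lvl} {t : Term C F l} {u : Obj C F} (h : SN R (.app t u)) : SN R t :=
  SN.of_map (fun t => .app t u) (fun _ _ h => .appFun u h) h

theorem SN.of_app_right {l : Lvl} {t : Term C F l} {u : Obj C F} (h : SN R (.app t u)) :
    SN R u :=
  SN.of_map (fun u => .app t u) (fun _ _ h => .appArg t h) h

theorem SN.of_apps {l : Lvl} {t : Term C F l} {us : List (Obj C F)} (h : SN R (apps t us)) :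
    SN R t ∧ ∀ u ∈ us, SN R u := by
  induction us generalizing t with
  | nil => exact ⟨h, by simp⟩
  | cons u us ih =>
    obtain ⟨h₁, h₂⟩ := ih h
    exact ⟨h₁.of_app_left, by simpa using ⟨h₁.of_app_right, h₂⟩⟩

theorem SN.var (n : ℕ) : SN R (.var n : Obj C F) := ⟨_, fun _ h => (not_step_var h).elim⟩

theorem SN.lam {l : Lvl} {U : Ty C F} {t : Term C F l} (hU : SN R U) (ht : SN R t) :
    SN R (.lam U t) := by
  induction hU generalizing t with
  | intro U hU ihU =>
    induction ht with
    | intro t ht iht =>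
      refine ⟨_, fun s hs => ?_⟩
      rcases step_lam_inv hs with ⟨_, h, rfl⟩ | ⟨_, h, rfl⟩
      · exact ihU _ h ⟨_, ht⟩
      · exact iht _ h

theorem SN.pi {U T : Ty C F} (hU : SN R U) (hT : SN R T) : SN R (.pi U T) := by
  induction hU generalizing T with
  | intro U hU ihU =>
    induction hT with
    | intro T hT ihT =>
      refine ⟨_, fun s hs => ?_⟩
      rcases step_pi_inv hs with ⟨_, h, rfl⟩ | ⟨_, h, rfl⟩
      · exact ihU _ h ⟨_, hT⟩
      · exact ihT _ h

theorem SN.app_of_conHeaded {l : Lvl} {t : Term C F l} {u : Obj C F} (hc : t.ConHeaded)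
    (ht : SN R t) (hu : SN R u) : SN R (.app t u) := by
  induction ht generalizing u with
  | intro t ht iht =>
    induction hu with
    | intro u hu ihu =>
      refine ⟨_, fun s hs => ?_⟩
      rcases step_app_inv hs with ⟨_, _, rfl, _⟩ | ⟨f, ps, r, σ, _, e, _⟩ | ⟨_, h, rfl⟩ | ⟨_, h, rfl⟩
      · exact hc.elim
      · exact (not_conHeaded_apps_fn f (ps.map (Term.subst σ)) (e ▸ hc)).elim
      · exact iht _ h (hc.step h) ⟨_, hu⟩
      · exact ihu _ h

/-! ### Reduction of argument lists -/

/-- One step in one element of a list. -/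
inductive ListStep (R : Rules C F) : List (Obj C F) → List (Obj C F) → Prop
  | head {u u' : Obj C F} (us : List (Obj C F)) : Step R u u' → ListStep R (u :: us) (u' :: us)
  | tail (u : Obj C F) {us us' : List (Obj C F)} :
      ListStep R us us' → ListStep R (u :: us) (u :: us')

theorem ListStep.red {us us' : List (Obj C F)} (h : ListStep R us us') :
    List.Forall₂ (Red R) us us' := by
  have hrefl : ∀ us : List (Obj C F), List.Forall₂ (Red R) us us :=
    fun us => List.forall₂_same.2 fun _ _ => .refl
  induction h with
  | head us h => exact .cons (.single h) (hrefl _)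
  | tail u _ ih => exact .cons .refl ih

theorem ListStep.append_left (vs : List (Obj C F)) {us us' : List (Obj C F)}
    (h : ListStep R us us') : ListStep R (vs ++ us) (vs ++ us') := by
  induction vs with
  | nil => exact h
  | cons v vs ih => exact .tail _ ih

theorem ListStep.append_right {us us' : List (Obj C F)} (h : ListStep R us us')
    (vs : List (Obj C F)) : ListStep R (us ++ vs) (us' ++ vs) := by
  induction h with
  | head us h => exact .head _ h
  | tail u _ ih => exact .tail _ ih

theorem acc_listStep {us : List (Obj C F)} (h : ∀ u ∈ us, SN R u) :
    Acc (fun x y => ListStep R y x) us := by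
  induction us with
  | nil => exact ⟨_, fun _ h => by cases h⟩
  | cons u us ih =>
    have hus := ih fun v hv => h v (by simp [hv])
    have hu : SN R u := h u (by simp)
    clear h ih
    induction hu generalizing us with
    | intro u hu ihu =>
      induction hus with
      | intro us hus ihus =>
        refine ⟨_, fun s hs => ?_⟩
        cases hs with
        | head _ h => exact ihu _ h us ⟨_, hus⟩
        | tail _ h => exact ihus _ h

theorem step_apps_fn_inv {l : Lvl} {f : F l} {us : List (Obj C F)} {s : Term C F l}
    (hR : S.IsRewriteSystem R) (hl : us.length ≤ S.arity ⟨l, f⟩)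
    (h : Step R (apps (.fn f) us) s) :
    (∃ ps r σ, R f ps r ∧ us = ps.map (Term.subst σ) ∧ s = r.subst σ) ∨
      ∃ us', ListStep R us us' ∧ s = apps (.fn f) us' := by
  induction us using List.reverseRecOn generalizing s with
  | nil =>
    generalize hx : apps (.fn f : Term C F l) [] = x at h
    cases h with
    | rule σ hr =>
      obtain ⟨rfl, e⟩ := apps_fn_inj hx
      exact .inl ⟨_, _, σ, hr, e, rfl⟩
    | _ => cases hx
  | append_singleton us u ih =>
    rw [apps_concat] at h
    rcases step_app_inv h with ⟨U, b, e, _⟩ | ⟨g, ps, r, σ, hr, e, rfl⟩ | ⟨t', h', rfl⟩ | ⟨u', h', rfl⟩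
    · rcases apps_fn_cases f us with ⟨_, h'⟩ | ⟨_, _, _, h'⟩ <;> rw [h'] at e <;> cases e
    · rw [← apps_concat] at e
      obtain ⟨rfl, e'⟩ := apps_fn_inj e
      exact .inl ⟨_, _, σ, hr, e', rfl⟩
    · rcases ih (by simp at hl; omega) h' with ⟨ps, r, σ, hr, e, rfl⟩ | ⟨us', hs, rfl⟩
      -- The patterns of a rule fill the arity of its head, so a strict prefix of the arguments is
      -- too short to match.
      · have := (hR _ _ _ _ hr).1
        rw [e] at hl
        simp at hl
        omega
      · exact .inr ⟨us' ++ [u], hs.append_right _, (apps_concat _ _ _).symm⟩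
    · exact .inr ⟨us ++ [u'], (ListStep.head _ h').append_left _, (apps_concat _ _ _).symm⟩

/-! ### The size order -/

/-- `t` is an argument of a constructor term `s`. -/
def CtorArg (S : Sig C F) (t s : Obj C F) : Prop :=
  ∃ c ts, S.IsCtor c ∧ t ∈ ts ∧ s = apps (.fn c) ts

/-- `t` is smaller than `s`: it is obtained from `s` by at least one reduction step or passage to an
argument of a constructor. -/
def Smaller (S : Sig C F) (R : Rules C F) : Obj C F → Obj C F → Prop :=
  Relation.TransGen fun t s => Step R s t ∨ CtorArg S t s

theorem ListStep.apps {l : Lvl} {us us' : List (Obj C F)} (h : ListStep R us us')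
    (t : Term C F l) : Step R (apps t us) (apps t us') := by
  have key : ∀ (us : List (Obj C F)) {t t' : Term C F l}, Step R t t' →
      Step R (LambdaPi.apps t us) (LambdaPi.apps t' us) := by
    intro us
    induction us with
    | nil => exact fun h => h
    | cons u us ih => exact fun h => ih (.appFun u h)
  induction h generalizing t with
  | head us h => exact key us (.appArg t h)
  | tail u _ ih => exact ih _

/-- Charges a reduction inside an argument to the surrounding constructor term, as needed in
`SN.acc_smaller`. -/
theorem CtorArg.step {t t' s : Obj C F} (h : CtorArg S t s) (ht : Step R t t') :
    ∃ s', Step R s s' ∧ CtorArg S t' s' := by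
  obtain ⟨c, ts, hc, hmem, rfl⟩ := h
  obtain ⟨l₁, l₂, rfl⟩ := List.append_of_mem hmem
  exact ⟨_, ((ListStep.head l₂ ht).append_left l₁).apps _, c, _, hc, by simp, rfl⟩

theorem CtorArg.sizeOf_lt {t s : Obj C F} (h : CtorArg S t s) : sizeOf t < sizeOf s := by
  obtain ⟨c, ts, _, hmem, rfl⟩ := h
  have key : ∀ (us : List (Obj C F)) (a : Obj C F),
      sizeOf a ≤ sizeOf (apps a us) ∧ ∀ u ∈ us, sizeOf u < sizeOf (apps a us) := by
    intro us
    induction us with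
    | nil => intro a; simp [apps]
    | cons u us ih =>
      intro a
      obtain ⟨h₁, h₂⟩ := ih (.app a u)
      simp only [Term.app.sizeOf_spec] at h₁
      refine ⟨?_, ?_⟩
      · show sizeOf a ≤ sizeOf (apps (.app a u) us)
        omega
      · intro v hv
        show sizeOf v < sizeOf (apps (.app a u) us)
        rcases List.mem_cons.1 hv with rfl | hv
        · omega
        · exact h₂ v hv
  exact (key ts _).2 t hmem

/-- A lexicographic argument on a pair: an ambient strongly normalizing object, and the size of an
iterated constructor argument of it. Reducing the argument reduces the ambient object; passing to a
further argument keeps the ambient object and lowers the size. -/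
theorem SN.acc_smaller {a : Obj C F} (h : SN R a) : Acc (Smaller S R) a := by
  refine Acc.transGen ?_
  suffices H : ∀ b, Relation.ReflTransGen (CtorArg S) b a →
      Acc (fun t s => Step R s t ∨ CtorArg S t s) b from H a .refl
  induction h with
  | intro a _ ih =>
    have hcomm : ∀ b b', Relation.ReflTransGen (CtorArg S) b a → Step R b b' →
        ∃ a', Step R a a' ∧ Relation.ReflTransGen (CtorArg S) b' a' := by
      intro b b' hb
      induction hb using Relation.ReflTransGen.head_induction_on generalizing b' with
      | refl => exact fun h => ⟨b', h, .refl⟩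
      | head h _ ih =>
        intro hs
        obtain ⟨c, hc, hbc⟩ := h.step hs
        obtain ⟨a', ha', hca⟩ := ih _ hc
        exact ⟨a', ha', .head hbc hca⟩
    intro b
    induction hn : sizeOf b using Nat.strong_induction_on generalizing b with
    | _ n ihn =>
      subst hn
      intro hb
      refine ⟨_, fun s hs => ?_⟩
      rcases hs with hs | hs
      · obtain ⟨a', ha', hsa⟩ := hcomm _ _ hb hs
        exact ih a' ha' s hsa
      · exact ihn _ hs.sizeOf_lt s rfl (.head hs hb)

theorem CtorSub.subst {t s : Obj C F} (h : CtorSub S t s) (σ : ℕ → Obj C F) :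
    CtorSub S (t.subst σ) (s.subst σ) := by
  have key : ∀ t s : Obj C F, (∃ c ts, S.IsCtor c ∧ t ∈ ts ∧ s = apps (.fn c) ts) →
      ∃ c ts, S.IsCtor c ∧ t.subst σ ∈ ts ∧ s.subst σ = apps (.fn c) ts := by
    rintro t _ ⟨c, ts, hc, hmem, rfl⟩
    exact ⟨c, ts.map (Term.subst σ), hc, List.mem_map_of_mem hmem, apps_subst _ _ _⟩
  induction h with
  | single h => exact .single (key _ _ h)
  | tail _ h ih => exact .tail ih (key _ _ h)

theorem CtorSub.smaller {t s : Obj C F} (h : CtorSub S t s) : Smaller S R t s := by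
  induction h with
  | single h => exact .single (.inr h)
  | tail _ h ih => exact .tail ih (.inr h)

theorem Red.eq_or_smaller {s t : Obj C F} (h : Red R s t) : t = s ∨ Smaller S R t s := by
  induction h with
  | refl => exact .inl rfl
  | tail _ h ih =>
    rcases ih with rfl | ih
    · exact .inr (.single (.inl h))
    · exact .inr (.head (.inl h) ih)

/-! ### Size-change termination makes calls well-founded -/

/-- `SizeRel S R A ts vs`: the matrix `A` describes how the sizes of the `vs` are bounded by those of
the `ts`. -/
def SizeRel (S : Sig C F) (R : Rules C F) {m n : ℕ} (A : SizeMatrix m n)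
    (ts vs : List (Obj C F)) : Prop :=
  ∀ i j, (A i j = -1 ∧ ∃ t v, ts[i.1]? = some t ∧ vs[j.1]? = some v ∧ Smaller S R v t) ∨
    (A i j = 0 ∧ ∃ t v, ts[i.1]? = some t ∧ vs[j.1]? = some v ∧ (v = t ∨ Smaller S R v t)) ∨
    A i j = ⊤

/-- An entry of the product is a minimum attained at some middle index, through which the two
comparisons compose. If there is no middle index, the entry is ∞ and claims nothing. -/
theorem SizeRel.comp {m n p : ℕ} {A : SizeMatrix m n} {B : SizeMatrix n p}
    {ts us vs : List (Obj C F)} (hA : SizeRel S R A ts us) (hB : SizeRel S R B us vs) :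
    SizeRel S R (A.comp B) ts vs := by
  intro i j
  have key : ∀ k : Fin n,
      (max (-1) (A i k + B k j) = -1 ∧
        ∃ t v, ts[i.1]? = some t ∧ vs[j.1]? = some v ∧ Smaller S R v t) ∨
      (max (-1) (A i k + B k j) = 0 ∧
        ∃ t v, ts[i.1]? = some t ∧ vs[j.1]? = some v ∧ (v = t ∨ Smaller S R v t)) ∨
      max (-1) (A i k + B k j) = ⊤ := by
    intro k
    rcases hA i k with ⟨ha, t, u, ht, hu, h⟩ | ⟨ha, t, u, ht, hu, h⟩ | ha
    · rcases hB k j with ⟨hb, u', v, hu', hv, h'⟩ | ⟨hb, u', v, hu', hv, h'⟩ | hb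
      · obtain rfl : u = u' := by simpa [hu] using hu'
        exact .inl ⟨by rw [ha, hb]; decide, t, v, ht, hv, h'.trans h⟩
      · obtain rfl : u = u' := by simpa [hu] using hu'
        refine .inl ⟨by rw [ha, hb]; decide, t, v, ht, hv, ?_⟩
        rcases h' with rfl | h'
        · exact h
        · exact h'.trans h
      · exact .inr (.inr (by rw [hb]; simp))
    · rcases hB k j with ⟨hb, u', v, hu', hv, h'⟩ | ⟨hb, u', v, hu', hv, h'⟩ | hb
      · obtain rfl : u = u' := by simpa [hu] using hu'
        refine .inl ⟨by rw [ha, hb]; decide, t, v, ht, hv, ?_⟩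
        rcases h with rfl | h
        · exact h'
        · exact h'.trans h
      · obtain rfl : u = u' := by simpa [hu] using hu'
        refine .inr (.inl ⟨by rw [ha, hb]; decide, t, v, ht, hv, ?_⟩)
        rcases h with rfl | h
        · exact h'
        · rcases h' with rfl | h'
          · exact .inr h
          · exact .inr (h'.trans h)
      · exact .inr (.inr (by rw [hb]; simp))
    · exact .inr (.inr (by rw [ha]; simp))
  rcases (Finset.univ : Finset (Fin n)).eq_empty_or_nonempty with he | hne
  · refine .inr (.inr ?_)
    simp only [SizeMatrix.comp, he, Finset.inf_empty]
  · obtain ⟨k, _, hk⟩ := Finset.exists_mem_eq_inf _ hne fun k => max (-1) (A i k + B k j)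
    simp only [SizeMatrix.comp, hk]
    exact key k

/-- `(g, vs)` is called by `(f, ts)`: the `ts` reduce to an instance of the patterns of a rule of `f`
whose right-hand side contains a call to `g`, and the `vs` are the strongly normalizing instances
of its arguments. -/
def CallRel (S : Sig C F) (R : Rules C F) (y x : Sym F × List (Obj C F)) : Prop :=
  ∃ ps k us σ ρ, List.Forall₂ (Red R) x.2 (ps.map (Term.subst σ)) ∧ Call S R x.1 ps k y.1 us ∧
    (∀ n, ρ (n + k) = σ n) ∧ y.2 = us.map (Term.subst ρ) ∧ ∀ v ∈ y.2, SN R v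

/-- Constructor subterms are stable under substitution, and the reductions that precede matching can
only decrease sizes. An entry 0 therefore stands for a weak decrease. -/
theorem CallRel.sizeRel {x y : Sym F × List (Obj C F)} (h : CallRel S R y x) :
    ∃ A, CallPath S R x.1 y.1 A ∧ SizeRel S R A x.2 y.2 := by
  obtain ⟨ps, k, us, σ, ρ, hred, hcall, hρ, hy, _⟩ := h
  refine ⟨_, .edge hcall, fun i j => ?_⟩
  have hshift : ∀ p : Obj C F, (p.shift k).subst ρ = p.subst σ := by
    intro p; rw [shift_subst]; congr 1; funext n; exact hρ n
  have hget : ∀ p, ps[i.1]? = some p → ∃ t, x.2[i.1]? = some t ∧ Red R t (p.subst σ) := by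
    intro p hp
    obtain ⟨hlen, hall⟩ := List.forall₂_iff_get.1 hred
    obtain ⟨hi, rfl⟩ := List.getElem?_eq_some_iff.1 hp
    have hi' : i.1 < x.2.length := by rw [hlen]; simpa using hi
    refine ⟨x.2[i.1], List.getElem?_eq_getElem hi', ?_⟩
    simpa using hall i.1 hi' (by simpa using hi)
  unfold callMatrix
  split_ifs with h₁ h₂
  · obtain ⟨p, t, hp, ht, hsub⟩ := h₁
    obtain ⟨a, ha, hr⟩ := hget p hp
    refine .inl ⟨rfl, a, t.subst ρ, ha, by rw [hy]; simp [ht], ?_⟩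
    have := (hsub.subst ρ).smaller (R := R)
    rw [hshift] at this
    rcases hr.eq_or_smaller (S := S) with e | h
    · rwa [e] at this
    · exact this.trans h
  · obtain ⟨p, t, hp, ht, rfl⟩ := h₂
    obtain ⟨a, ha, hr⟩ := hget p hp
    refine .inr (.inl ⟨rfl, a, p.subst σ, ha, by rw [hy]; simp [ht, hshift], ?_⟩)
    exact hr.eq_or_smaller
  · exact .inr (.inr rfl)

theorem acc_callRel (hfin : (Defined R).Finite) (hSCT : SizeChangeTerminating S R)
    (x : Sym F × List (Obj C F)) (hx : ∀ v ∈ x.2, SN R v) : Acc (CallRel S R) x := by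
  by_contra hacc
  obtain ⟨c, rfl, hc⟩ := not_acc_iff_exists_descending_chain.1 hacc
  have hsn : ∀ n, ∀ v ∈ (c n).2, SN R v := by
    intro n
    cases n with
    | zero => exact hx
    | succ n => obtain ⟨_, _, _, _, _, _, _, _, _, h⟩ := hc n; exact h
  have hdef : ∀ n, (c n).1 ∈ Defined R := by
    intro n
    obtain ⟨ps, _, _, _, _, _, ⟨r, hr, _⟩, _⟩ := hc n
    exact ⟨ps, r, hr⟩
  have hpath : ∀ m d, ∃ A, CallPath S R (c m).1 (c (m + d + 1)).1 A ∧
      SizeRel S R A (c m).2 (c (m + d + 1)).2 := by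
    intro m d
    induction d with
    | zero => exact (hc m).sizeRel
    | succ d ih =>
      obtain ⟨A, hA, hA'⟩ := ih
      obtain ⟨B, hB, hB'⟩ := (hc (m + d + 1)).sizeRel
      exact ⟨_, hA.comp hB, hA'.comp hB'⟩
  -- Pigeonhole: every symbol of the chain makes a call, hence heads a rule, and there are finitely
  -- many of those.
  obtain ⟨f, hf⟩ : ∃ f : Defined R, Infinite ((fun n => (⟨(c n).1, hdef n⟩ : Defined R)) ⁻¹' {f}) := by
    have := hfin.to_subtype
    exact Finite.exists_infinite_fiber _
  have hinf : {n | (c n).1 = f.1}.Infinite := by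
    refine (Set.infinite_coe_iff.1 hf).mono ?_
    intro n hn
    exact congrArg Subtype.val hn
  -- The default value is normal, so a rank exists at every position even if the list of arguments
  -- is shorter than the arity.
  have hacc' : ∀ n i, Acc (Smaller S R) ((c n).2.getD i (.var 0)) := by
    intro n i
    refine SN.acc_smaller ?_
    rw [List.getD_eq_getElem?_getD]
    rcases h : (c n).2[i]? with _ | t
    · exact SN.var 0
    · exact hsn n t (List.mem_of_getElem? h)
  classical
  have := hinf.to_subtype
  let φ := Nat.orderEmbeddingOfSet {n | (c n).1 = f.1}
  have hφ : ∀ n, (c (φ n)).1 = f.1 := by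
    intro n
    have : φ n ∈ Set.range φ := ⟨n, rfl⟩
    rwa [Nat.orderEmbeddingOfSet_range] at this
  -- Dickson's lemma for tuples of ordinals: two visits of the symbol such that no rank is lower at
  -- the later one. This takes the place of a Ramsey argument.
  obtain ⟨m, n, hmn, hle⟩ := wellQuasiOrdered_le
    (fun (n : ℕ) (i : Fin (S.arity f.1)) => (hacc' (φ n) i).rank)
  obtain ⟨d, hd⟩ := Nat.exists_eq_add_of_lt (φ.strictMono hmn)
  have hmn' := hpath (φ m) d
  rw [← hd] at hmn'
  obtain ⟨A, hA, hA'⟩ := hmn'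
  -- Both end points are generalized because the dimensions of the matrix depend on them;
  -- identifying them makes it square.
  have key : ∀ g h : Sym F, g = f.1 → h = f.1 → ∀ A : SizeMatrix (S.arity g) (S.arity h),
      CallPath S R g h A → SizeRel S R A (c (φ m)).2 (c (φ n)).2 → False := by
    rintro _ _ rfl rfl A hA hA'
    obtain ⟨i, hi⟩ := hSCT _ A hA
    rcases hA' i i with ⟨_, t, v, ht, hv, h⟩ | ⟨h, _⟩ | h
    · refine absurd (hle i) (not_le.2 ?_)
      refine Acc.rank_lt_of_rel (hacc' (φ m) i) ?_
      simpa [List.getD_eq_getElem?_getD, ht, hv] using h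
    · rw [hi] at h; exact absurd h (by decide)
    · rw [hi] at h; exact absurd h (by decide)
  exact key _ _ (hφ m) (hφ n) A hA hA'

/-! ### Reducibility candidates -/

/-- Application of a function symbol to fewer arguments than its arity. -/
def PartialApp (S : Sig C F) {l : Lvl} (t : Term C F l) : Prop :=
  ∃ (f : F l) (us : List (Obj C F)), us.length < S.arity ⟨l, f⟩ ∧ t = apps (.fn f) us

/-- Abstractions and products. -/
def Term.IsBinder : {l : Lvl} → Term C F l → Prop
  | _, .lam _ _ => True
  | _, .pi _ _ => True
  | _, _ => False

/-- Terms whose application to an argument is not a redex. -/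
def Neutral (S : Sig C F) {l : Lvl} (t : Term C F l) : Prop :=
  ¬ t.IsBinder ∧ ¬ PartialApp S t

theorem not_partialApp_lam {l : Lvl} (U : Ty C F) (t : Term C F l) :
    ¬ PartialApp S (.lam U t) := by
  rintro ⟨f, us, _, e⟩
  rcases apps_fn_cases f us with ⟨_, h⟩ | ⟨_, _, _, h⟩ <;> rw [h] at e <;> cases e

theorem neutral_app {l : Lvl} {t : Term C F l} (ht : ¬ PartialApp S t) (u : Obj C F) :
    Neutral S (.app t u) := by
  refine ⟨id, ?_⟩
  rintro ⟨f, us, hl, e⟩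
  rcases apps_fn_cases f us with ⟨_, h⟩ | ⟨vs, v, rfl, h⟩
  · rw [h] at e; cases e
  · rw [h] at e
    refine ht ⟨f, vs, ?_, (Term.app.inj e).1⟩
    simp at hl
    omega

theorem neutral_var (n : ℕ) : Neutral S (.var n : Obj C F) := by
  refine ⟨id, ?_⟩
  rintro ⟨f, us, _, e⟩
  rcases apps_fn_cases f us with ⟨_, h⟩ | ⟨_, _, _, h⟩ <;> rw [h] at e <;> cases e

theorem neutral_apps_fn {l : Lvl} (f : F l) {us : List (Obj C F)}
    (h : S.arity ⟨l, f⟩ ≤ us.length) : Neutral S (apps (.fn f : Term C F l) us) := by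
  constructor
  · rcases apps_fn_cases f us with ⟨_, h⟩ | ⟨_, _, _, h⟩ <;> rw [h] <;> exact id
  · rintro ⟨g, vs, hl, e⟩
    obtain ⟨rfl, rfl⟩ := apps_fn_inj e
    omega

/-- Steps from the application of a term that is neither an abstraction nor a partial application. -/
theorem step_app_inv_of_not_partialApp (hR : S.IsRewriteSystem R) {l : Lvl} {t s : Term C F l}
    {u : Obj C F} (ht : ¬ PartialApp S t) (h : Step R (.app t u) s) :
    (∃ U b, t = .lam U b ∧ s = b.inst u) ∨
    (∃ t', Step R t t' ∧ s = .app t' u) ∨ ∃ u', Step R u u' ∧ s = .app t u' := by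
  rcases step_app_inv h with h | ⟨f, ps, r, σ, hr, e, _⟩ | h | h
  · exact .inl h
  · rcases apps_fn_cases f (ps.map (Term.subst σ)) with ⟨_, h'⟩ | ⟨vs, v, hvs, h'⟩
    · rw [h'] at e; cases e
    · rw [h'] at e
      refine absurd ⟨f, vs, ?_, (Term.app.inj e).1⟩ ht
      have h₁ := congrArg List.length hvs
      have h₂ := (hR _ _ _ _ hr).1
      simp at h₁
      omega
  · exact .inr (.inl h)
  · exact .inr (.inr h)

/-- Reducibility candidates. -/
structure IsCand (S : Sig C F) (R : Rules C F) {l : Lvl} (X : Term C F l → Prop) : Prop where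
  sn : ∀ {t}, X t → SN R t
  step : ∀ {t t'}, X t → Step R t t' → X t'
  neutral : ∀ {t}, Neutral S t → (∀ t', Step R t t' → X t') → X t

theorem IsCand.red {l : Lvl} {X : Term C F l → Prop} (hX : IsCand S R X) {t t' : Term C F l}
    (ht : X t) (h : Red R t t') : X t' := by
  induction h with
  | refl => exact ht
  | tail _ h ih => exact hX.step ih h

theorem IsCand.var {X : Obj C F → Prop} (hX : IsCand S R X) (n : ℕ) : X (.var n) :=
  hX.neutral (neutral_var n) fun _ h => (not_step_var h).elim

/-- Candidates are closed under weak head `β`-expansion. -/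
theorem IsCand.beta (hR : S.IsRewriteSystem R) {l : Lvl} {X : Term C F l → Prop}
    (hX : IsCand S R X) {U : Ty C F} {t : Term C F l} {u : Obj C F} (hU : SN R U) (ht : SN R t)
    (hu : SN R u) (h : X (t.inst u)) : X (.app (.lam U t) u) := by
  induction hU generalizing t u with
  | intro U hU ihU =>
    induction ht generalizing u with
    | intro t ht iht =>
      induction hu with
      | intro u hu ihu =>
        refine hX.neutral (neutral_app (not_partialApp_lam _ _) _) fun s hs => ?_
        rcases step_app_inv_of_not_partialApp hR (not_partialApp_lam _ _) hs with
          ⟨_, _, e, rfl⟩ | ⟨t', hs', rfl⟩ | ⟨u', hs', rfl⟩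
        · cases e; exact h
        · rcases step_lam_inv hs' with ⟨U', hs'', rfl⟩ | ⟨t'', hs'', rfl⟩
          · exact ihU _ hs'' ⟨_, ht⟩ ⟨_, hu⟩ h
          · exact iht _ hs'' ⟨_, hu⟩ (hX.step h (hs''.subst _))
        · exact ihu _ hs' (hX.red h (red_inst_of_red t (.single hs')))

theorem isCand_sn : IsCand S R (SN R : Obj C F → Prop) :=
  ⟨fun h => h, fun h hs => h.step hs, fun _ h => ⟨_, h⟩⟩

/-! ### Interpretable types -/

/-- `Interp R T P`: the type `T` is interpreted by the set of objects `P`. -/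
inductive Interp (R : Rules C F) : Ty C F → (Obj C F → Prop) → Prop
  | pi {T U V : Ty C F} {P : Obj C F → Prop} {Q : Obj C F → Obj C F → Prop} :
      Conv R T (.pi U V) → Interp R U P → (∀ u, P u → Interp R (V.inst u) (Q u)) →
      Interp R T (fun t => ∀ u, P u → Q u (.app t u))
  | base {T : Ty C F} : (∀ U V, ¬ Conv R T (.pi U V)) → Interp R T (SN R)

/-- `T` has an interpretation. -/
def Interpretable (R : Rules C F) (T : Ty C F) : Prop := ∃ P, Interp R T P

theorem Interp.conv {T T' : Ty C F} {P : Obj C F → Prop} (h : Interp R T P) (hT : Conv R T T') :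
    Interp R T' P := by
  cases h with
  | pi hc hU hV => exact .pi (hT.symm.trans _ _ _ hc) hU hV
  | base hc => exact .base fun U V h => hc U V (hT.trans _ _ _ h)

theorem Interpretable.conv {T T' : Ty C F} (h : Interpretable R T) (hT : Conv R T T') :
    Interpretable R T' := h.imp fun _ h => h.conv hT

/-- The applicable clause depends only on the conversion class of the type, and two products in one
class have convertible components. -/
theorem Interp.unique (hconf : ∀ l : Lvl, IsConfluent (Step R (l := l))) {T T' : Ty C F}
    {P P' : Obj C F → Prop} (h : Interp R T P) (h' : Interp R T' P') (hT : Conv R T T') :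
    P = P' := by
  induction h generalizing T' P' with
  | pi hc _ _ ihU ihV =>
    cases h' with
    | pi hc' hU' hV' =>
      obtain ⟨h₁, h₂⟩ := Conv.pi_inj hconf ((hc.symm.trans _ _ _ hT).trans _ _ _ hc')
      obtain rfl := ihU hU' h₁
      funext t
      refine propext (forall_congr' fun u => forall_congr' fun hu => ?_)
      rw [ihV u hu (hV' u hu) (h₂.subst _)]
    | base hc' => exact absurd (hT.symm.trans _ _ _ hc) (hc' _ _)
  | base hc =>
    cases h' with
    | pi hc' => exact absurd (hT.trans _ _ _ hc') (hc _ _)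
    | base => rfl

theorem Interp.isCand (hR : S.IsRewriteSystem R)
    (hconf : ∀ l : Lvl, IsConfluent (Step R (l := l))) {T : Ty C F} {P : Obj C F → Prop}
    (h : Interp R T P) : IsCand S R P := by
  induction h with
  | base => exact isCand_sn
  | @pi T U V P Q hc hU hV ihU ihV =>
    refine ⟨fun {t} ht => ?_, fun {t t'} ht hs u hu => ?_, fun {t} hn ht u hu => ?_⟩
    -- The candidate of the domain contains the variables, so there is always an argument to apply
    -- to.
    · exact ((ihV _ (ihU.var 0)).sn (ht _ (ihU.var 0))).of_app_left
    · exact (ihV u hu).step (ht u hu) (.appFun u hs)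
    · have husn := ihU.sn hu
      induction husn with
      | intro u _ ihu =>
        refine (ihV u hu).neutral (neutral_app hn.2 u) fun s hs => ?_
        rcases step_app_inv_of_not_partialApp hR hn.2 hs with
          ⟨_, _, rfl, _⟩ | ⟨t', hs', rfl⟩ | ⟨u', hs', rfl⟩
        · exact absurd trivial hn.1
        · exact ht t' hs' u hu
        · have hu' := ihU.step hu hs'
          -- A priori `Q` may differ at `u` and its reduct, but the two instances of the codomain
          -- are convertible.
          rw [(hV u hu).unique hconf (hV u' hu') (red_inst_of_red V (.single hs')).conv]
          exact ihu u' hs' hu'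

/-- The constructor `Interp.pi` only provides some convertible product; injectivity transports its
data to the given components. -/
theorem Interp.pi_inv (hconf : ∀ l : Lvl, IsConfluent (Step R (l := l))) {U V : Ty C F}
    {X : Obj C F → Prop} (h : Interp R (.pi U V) X) :
    ∃ (P : Obj C F → Prop) (Q : Obj C F → Obj C F → Prop), Interp R U P ∧
      (∀ u, P u → Interp R (V.inst u) (Q u)) ∧ X = fun t => ∀ u, P u → Q u (.app t u) := by
  generalize hT : Term.pi U V = T at h
  cases h with
  | @pi _ U' V' P Q hc hU hV =>
    subst hT
    obtain ⟨h₁, h₂⟩ := Conv.pi_inj hconf hc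
    exact ⟨P, Q, hU.conv h₁.symm, fun u hu => (hV u hu).conv (Conv.subst h₂.symm _), rfl⟩
  | base hc => subst hT; exact absurd (.refl _) (hc _ _)

/-! ### The total interpretation of types -/

/-- Computable objects of an arbitrary type. An object of a type without interpretation is computable
if none of its reducts is a partial application and if its reducts that are abstractions have an
interpretable domain and map computable objects to computable objects. -/
inductive Comp (S : Sig C F) (R : Rules C F) : Ty C F → Obj C F → Prop
  | interp {T : Ty C F} {P : Obj C F → Prop} {t : Obj C F} : Interp R T P → P t → Comp S R T t
  | other {T : Ty C F} {t : Obj C F} : ¬ Interpretable R T → SN R t →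
      (∀ s, Red R t s → ¬ PartialApp S s) →
      (∀ U b U' B, Red R t (.lam U b) → Conv R T (.pi U' B) →
        Conv R U U' ∧ Interpretable R U) →
      (∀ U b U' B P u, Red R t (.lam U b) → Conv R T (.pi U' B) → Interp R U P → P u →
        Comp S R (B.inst u) (b.inst u)) → Comp S R T t

theorem Interp.comp_iff (hconf : ∀ l : Lvl, IsConfluent (Step R (l := l))) {T : Ty C F}
    {P : Obj C F → Prop} (h : Interp R T P) {t : Obj C F} : Comp S R T t ↔ P t := by
  refine ⟨fun ht => ?_, fun ht => .interp h ht⟩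
  cases ht with
  | interp h' ht => rwa [h.unique hconf h' (.refl _)]
  | other hn => exact absurd ⟨P, h⟩ hn

theorem Comp.conv {T T' : Ty C F} {t : Obj C F} (h : Comp S R T t) (hT : Conv R T T') :
    Comp S R T' t := by
  cases h with
  | interp h ht => exact .interp (h.conv hT) ht
  | other hn hsn hp hl hb =>
    exact .other (fun h => hn (h.conv hT.symm)) hsn hp
      (fun U b U' B hr hc => hl U b U' B hr (hT.trans _ _ _ hc))
      (fun U b U' B P u hr hc => hb U b U' B P u hr (hT.trans _ _ _ hc))

theorem comp_eq_of_conv {T T' : Ty C F} (hT : Conv R T T') : Comp S R T = Comp S R T' :=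
  funext fun _ => propext ⟨fun h => h.conv hT, fun h => h.conv hT.symm⟩

/-- At a type without interpretation the conditions quantify over all reducts, so they are inherited
by reducts. A neutral term is itself neither a partial application nor an abstraction, so its
conditions follow from those of its one-step reducts. -/
theorem isCand_comp (hR : S.IsRewriteSystem R)
    (hconf : ∀ l : Lvl, IsConfluent (Step R (l := l))) (T : Ty C F) :
    IsCand S R (Comp S R T) := by
  by_cases hT : Interpretable R T
  · obtain ⟨P, hP⟩ := hT
    rw [show Comp S R T = P from funext fun t => propext (hP.comp_iff hconf)]
    exact hP.isCand hR hconf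
  have key : ∀ {t}, Comp S R T t → SN R t ∧ (∀ s, Red R t s → ¬ PartialApp S s) ∧
      (∀ U b U' B, Red R t (.lam U b) → Conv R T (.pi U' B) →
        Conv R U U' ∧ Interpretable R U) ∧
      (∀ U b U' B P u, Red R t (.lam U b) → Conv R T (.pi U' B) → Interp R U P → P u →
        Comp S R (B.inst u) (b.inst u)) := by
    intro t ht
    cases ht with
    | interp h => exact absurd ⟨_, h⟩ hT
    | other _ hsn hp hl hb => exact ⟨hsn, hp, hl, hb⟩
  refine ⟨fun ht => (key ht).1, fun {t t'} ht hs => ?_, fun {t} hn ht => ?_⟩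
  · obtain ⟨hsn, hp, hl, hb⟩ := key ht
    exact .other hT (hsn.step hs) (fun s hr => hp s (.head hs hr))
      (fun U b U' B hr => hl U b U' B (.head hs hr))
      (fun U b U' B P u hr => hb U b U' B P u (.head hs hr))
  · refine .other hT ⟨_, fun t' hs => (key (ht t' hs)).1⟩ ?_ ?_ ?_
    · intro s hr
      rcases Relation.ReflTransGen.cases_head hr with rfl | ⟨t', hs, hr⟩
      · exact hn.2
      · exact (key (ht t' hs)).2.1 s hr
    · intro U b U' B hr
      rcases Relation.ReflTransGen.cases_head hr with rfl | ⟨t', hs, hr⟩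
      · exact absurd trivial hn.1
      · exact (key (ht t' hs)).2.2.1 U b U' B hr
    · intro U b U' B P u hr
      rcases Relation.ReflTransGen.cases_head hr with rfl | ⟨t', hs, hr⟩
      · exact absurd trivial hn.1
      · exact (key (ht t' hs)).2.2.2 U b U' B P u hr

/-- If the product has an interpretation, this is weak head expansion. Otherwise the reducts of an
abstraction are abstractions with reduced components, and product injectivity handles the other
product forms of the type. -/
theorem Comp.lam (hR : S.IsRewriteSystem R)
    (hconf : ∀ l : Lvl, IsConfluent (Step R (l := l))) {U B : Ty C F} {t : Obj C F}
    {P : Obj C F → Prop} (hU : SN R U) (hP : Interp R U P)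
    (ht : ∀ u, P u → Comp S R (B.inst u) (t.inst u)) : Comp S R (.pi U B) (.lam U t) := by
  have hPc := hP.isCand hR hconf
  have htsn : SN R t := ((isCand_comp hR hconf _).sn (ht _ (hPc.var 0))).of_subst
  by_cases hI : Interpretable R (.pi U B)
  · obtain ⟨X, hX⟩ := hI
    refine .interp hX ?_
    obtain ⟨P', Q, hP', hQ, rfl⟩ := hX.pi_inv hconf
    obtain rfl := hP.unique hconf hP' (.refl _)
    intro u hu
    exact ((hQ u hu).isCand hR hconf).beta hR hU htsn (hPc.sn hu)
      (((hQ u hu).comp_iff hconf).1 (ht u hu))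
  · refine .other hI (hU.lam htsn) ?_ ?_ ?_
    · intro s hs
      obtain ⟨U', t', rfl, _, _⟩ := red_lam_inv hs
      exact not_partialApp_lam _ _
    · intro U₁ b U₂ B₂ hr hc
      obtain ⟨_, _, e, hU₁, _⟩ := red_lam_inv hr
      cases e
      exact ⟨hU₁.conv.symm.trans _ _ _ (hc.pi_inj hconf).1, P, hP.conv hU₁.conv⟩
    · intro U₁ b U₂ B₂ P' u hr hc hP' hu
      obtain ⟨_, _, e, hU₁, hb⟩ := red_lam_inv hr
      cases e
      rw [← hP.unique hconf hP' hU₁.conv] at hu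
      exact ((isCand_comp hR hconf _).red (ht u hu) (hb.subst _)).conv
        ((hc.pi_inj hconf).2.subst _)

/-- If the product has no interpretation, a computable function is not a partial application. The
application is then neutral, and induction on the normalization of both sides leaves only the head
β-step, covered by the condition on abstractions. -/
theorem Comp.app (hR : S.IsRewriteSystem R)
    (hconf : ∀ l : Lvl, IsConfluent (Step R (l := l))) {U B : Ty C F} {t u : Obj C F}
    (ht : Comp S R (.pi U B) t) (hu : Comp S R U u) : Comp S R (B.inst u) (.app t u) := by
  by_cases hI : Interpretable R (.pi U B)
  · obtain ⟨X, hX⟩ := hI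
    have htX := (hX.comp_iff hconf).1 ht
    obtain ⟨P, Q, hP, hQ, rfl⟩ := hX.pi_inv hconf
    have huP := (hP.comp_iff hconf).1 hu
    exact .interp (hQ u huP) (htX u huP)
  have htsn := (isCand_comp hR hconf _).sn ht
  have husn := (isCand_comp hR hconf _).sn hu
  induction htsn generalizing u with
  | intro t htsn iht =>
    induction husn with
    | intro u husn ihu =>
      have ht' := ht
      cases ht with
      | interp h => exact absurd ⟨_, h⟩ hI
      | other _ _ hp hl hb =>
        have hpt := hp t .refl
        refine (isCand_comp hR hconf _).neutral (neutral_app hpt u) fun s hs => ?_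
        rcases step_app_inv_of_not_partialApp hR hpt hs with
          ⟨U', b, rfl, rfl⟩ | ⟨t', hs', rfl⟩ | ⟨u', hs', rfl⟩
        -- The domain of the abstraction brings an interpretation, which conversion passes on to the
        -- type of `u`.
        · obtain ⟨hUU', P, hP⟩ := hl U' b U B .refl (.refl _)
          exact hb U' b U B P u .refl (.refl _) hP
            (((hP.conv hUU').comp_iff hconf).1 hu)
        · exact iht t' hs' ((isCand_comp hR hconf _).step ht' hs') hu ⟨_, husn⟩
        · exact (ihu u' hs' ((isCand_comp hR hconf _).step hu hs')).conv
            (red_inst_of_red B (.single hs')).conv.symm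

/-! ### Computable types -/

/-- Computable terms of kind `K`, under the substitution `σ`. -/
def KComp (S : Sig C F) (R : Rules C F) : Kd C F → (ℕ → Obj C F) → Ty C F → Prop
  | .type, _, T => SN R T ∧ Interpretable R T
  | .pi U K, σ, T => ∀ u, Comp S R (U.subst σ) u → KComp S R K (scons u σ) (.app T u)

theorem scons_subst_scons (u : Obj C F) (ρ σ : ℕ → Obj C F) :
    scons u (fun n => (ρ n).subst σ) = fun n => (liftSub ρ n).subst (scons u σ) := by
  funext n
  cases n with
  | zero => rfl
  | succ n => simp only [liftSub, shift_subst]; rfl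

theorem kComp_subst (K : Kd C F) (ρ σ : ℕ → Obj C F) :
    KComp S R (K.subst ρ) σ = KComp S R K (fun n => (ρ n).subst σ) := by
  induction K generalizing ρ σ with
  | type => rfl
  | pi U K ih =>
    funext T
    simp only [Kd.subst, KComp, subst_subst, ih, scons_subst_scons]

theorem kComp_inst (K : Kd C F) (u : Obj C F) (σ : ℕ → Obj C F) :
    KComp S R (K.inst u) σ = KComp S R K (scons (u.subst σ) σ) := by
  simp only [Kd.inst, kComp_subst, single_eq_scons, scons_comp, Term.subst]

theorem kComp_eq_of_conv {K K' : Kd C F} (h : Relation.EqvGen (KStep R) K K')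
    (σ : ℕ → Obj C F) : KComp S R K σ = KComp S R K' σ := by
  induction h with
  | rel K K' h =>
    induction h generalizing σ with
    | piDom K h =>
      funext T
      simp only [KComp, comp_eq_of_conv (S := S) (.rel _ _ (h.subst σ))]
    | piCod U h ih => funext T; simp only [KComp, ih]
  | refl => rfl
  | symm _ _ _ ih => exact ih.symm
  | trans _ _ _ _ _ ih₁ ih₂ => exact ih₁.trans ih₂

theorem kComp_eq_of_red (K : Kd C F) {σ σ' : ℕ → Obj C F} (h : ∀ n, Red R (σ n) (σ' n)) :
    KComp S R K σ = KComp S R K σ' := by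
  induction K generalizing σ σ' with
  | type => rfl
  | pi U K ih =>
    funext T
    simp only [KComp, comp_eq_of_conv (S := S) (red_subst_of_red U h).conv]
    refine propext (forall_congr' fun u => forall_congr' fun _ => ?_)
    rw [ih (red_scons .refl h)]

theorem isCand_kComp (hR : S.IsRewriteSystem R)
    (hconf : ∀ l : Lvl, IsConfluent (Step R (l := l))) (K : Kd C F) (σ : ℕ → Obj C F) :
    IsCand S R (KComp S R K σ) := by
  induction K generalizing σ with
  | type =>
    refine ⟨fun h => h.1, fun h hs => ⟨h.1.step hs, h.2.conv (.rel _ _ hs)⟩, fun {T} hn h => ?_⟩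
    refine ⟨⟨_, fun T' hs => (h T' hs).1⟩, ?_⟩
    by_cases hT : ∃ T', Step R T T'
    · obtain ⟨T', hs⟩ := hT
      exact (h T' hs).2.conv (Relation.EqvGen.rel _ _ hs).symm
    -- By confluence, a normal type that is not a product is convertible to no product.
    · refine ⟨_, .base fun U V hc => ?_⟩
      obtain ⟨s, h₁, h₂⟩ := hc.exists_red hconf
      obtain ⟨U', V', rfl, _, _⟩ := red_pi_inv h₂
      rcases Relation.ReflTransGen.cases_head h₁ with rfl | ⟨T', hs, _⟩
      · exact absurd trivial hn.1
      · exact hT ⟨T', hs⟩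
  | pi U K ih =>
    have hU := isCand_comp hR hconf (U.subst σ)
    refine ⟨fun {t} ht => ?_, fun {t t'} ht hs u hu => ?_, fun {t} hn ht u hu => ?_⟩
    · exact ((ih _).sn (ht _ (hU.var 0))).of_app_left
    · exact (ih _).step (ht u hu) (.appFun u hs)
    · have husn := hU.sn hu
      induction husn with
      | intro u _ ihu =>
        refine (ih _).neutral (neutral_app hn.2 u) fun s hs => ?_
        rcases step_app_inv_of_not_partialApp hR hn.2 hs with
          ⟨_, _, rfl, _⟩ | ⟨t', hs', rfl⟩ | ⟨u', hs', rfl⟩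
        · exact absurd trivial hn.1
        · exact ht t' hs' u hu
        · rw [kComp_eq_of_red K (red_scons (.single hs') fun _ => .refl)]
          exact ihu u' hs' (hU.step hu hs')

theorem kComp_of_conHeaded (hR : S.IsRewriteSystem R)
    (hconf : ∀ l : Lvl, IsConfluent (Step R (l := l))) (K : Kd C F) (σ : ℕ → Obj C F)
    {T : Ty C F} (hT : T.ConHeaded) (hsn : SN R T) : KComp S R K σ T := by
  induction K generalizing σ T with
  | type => exact ⟨hsn, _, .base fun _ _ => hT.not_conv_pi hconf⟩
  | pi U K ih =>
    intro u hu
    exact ih _ hT (.app_of_conHeaded hT hsn ((isCand_comp hR hconf _).sn hu))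

/-! ### Computable arguments -/

/-- The `us` are computable arguments for the type `A`, leaving the type `B`. -/
inductive Args (S : Sig C F) (R : Rules C F) : Ty C F → List (Obj C F) → Ty C F → Prop
  | nil (A : Ty C F) : Args S R A [] A
  | cons {A B B' : Ty C F} {u : Obj C F} {us : List (Obj C F)} : Comp S R A u →
      Args S R (B.inst u) us B' → Args S R (.pi A B) (u :: us) B'

/-- The `us` are computable arguments, in the right number, for the kind `K` under `σ`. -/
def KArgs (S : Sig C F) (R : Rules C F) : Kd C F → (ℕ → Obj C F) → List (Obj C F) → Prop
  | .type, _, [] => True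
  | .pi U K, σ, u :: us => Comp S R (U.subst σ) u ∧ KArgs S R K (scons u σ) us
  | _, _, _ => False

theorem Args.sn (hR : S.IsRewriteSystem R)
    (hconf : ∀ l : Lvl, IsConfluent (Step R (l := l))) {A B : Ty C F} {us : List (Obj C F)}
    (h : Args S R A us B) : ∀ u ∈ us, SN R u := by
  induction h with
  | nil => simp
  | cons hu _ ih => simpa using ⟨(isCand_comp hR hconf _).sn hu, ih⟩

/-- Being convertible to a product does not make `A'` one; the bound on the arity does, and
instantiation preserves arities. -/
theorem Args.red (hR : S.IsRewriteSystem R)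
    (hconf : ∀ l : Lvl, IsConfluent (Step R (l := l))) {A A' B : Ty C F}
    {us us' : List (Obj C F)} (h : Args S R A us B) (hA : Conv R A A')
    (hl : us.length ≤ A'.arity) (hus : List.Forall₂ (Red R) us us') :
    ∃ B', Args S R A' us' B' ∧ Conv R B B' := by
  induction h generalizing A' us' with
  | nil A => cases hus; exact ⟨A', .nil _, hA⟩
  | @cons A B B' u us hu _ ih =>
    cases hus with
    | @cons _ u' _ us' hu' hus =>
      obtain ⟨U', V', rfl⟩ := eq_pi_of_arity_pos A' (by simp at hl; omega)
      obtain ⟨h₁, h₂⟩ := hA.pi_inj hconf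
      obtain ⟨B'', hB, hc⟩ := ih
        ((h₂.subst _).trans _ _ _ (red_inst_of_red V' hu').conv)
        (by rw [arity_inst]; simpa [Term.arity] using hl) hus
      exact ⟨B'', .cons (((isCand_comp hR hconf _).red hu hu').conv h₁) hB, hc⟩

theorem Args.eq_resultTy {T B : Ty C F} {ps : List (Obj C F)} {σ : ℕ → Obj C F}
    (h : Args S R (T.subst σ) (ps.map (Term.subst σ)) B) : B = (resultTy T ps).subst σ := by
  induction ps generalizing T with
  | nil =>
    generalize hT : T.subst σ = T' at h
    cases h
    simp only [resultTy, hT]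
  | cons p ps ih =>
    cases T with
    | pi U V =>
      simp only [Term.subst, List.map_cons] at h
      cases h with
      | cons _ h =>
        rw [← inst_subst_comm] at h
        simpa only [resultTy] using ih h
    | _ => simp only [Term.subst, List.map_cons] at h; cases h

theorem KArgs.sn (hR : S.IsRewriteSystem R)
    (hconf : ∀ l : Lvl, IsConfluent (Step R (l := l))) {K : Kd C F} {σ : ℕ → Obj C F}
    {us : List (Obj C F)} (h : KArgs S R K σ us) : ∀ u ∈ us, SN R u := by
  induction K generalizing σ us with
  | type =>
    cases us with
    | nil => simp
    | cons => exact h.elim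
  | pi U K ih =>
    cases us with
    | nil => exact h.elim
    | cons u us => simpa using ⟨(isCand_comp hR hconf _).sn h.1, ih h.2⟩

theorem KArgs.length_eq {K : Kd C F} {σ : ℕ → Obj C F} {us : List (Obj C F)}
    (h : KArgs S R K σ us) : us.length = K.arity := by
  induction K generalizing σ us with
  | type =>
    cases us with
    | nil => rfl
    | cons => exact h.elim
  | pi U K ih =>
    cases us with
    | nil => exact h.elim
    | cons u us => simp only [List.length_cons, Kd.arity, ih h.2]

theorem KArgs.red (hR : S.IsRewriteSystem R)
    (hconf : ∀ l : Lvl, IsConfluent (Step R (l := l))) {K : Kd C F} {σ σ' : ℕ → Obj C F}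
    {us us' : List (Obj C F)} (h : KArgs S R K σ us) (hσ : ∀ n, Red R (σ n) (σ' n))
    (hus : List.Forall₂ (Red R) us us') : KArgs S R K σ' us' := by
  induction K generalizing σ σ' us us' with
  | type =>
    cases hus with
    | nil => trivial
    | cons => exact h.elim
  | pi U K ih =>
    cases hus with
    | nil => exact h.elim
    | cons hu hus =>
      exact ⟨((isCand_comp hR hconf _).red h.1 hu).conv (red_subst_of_red U hσ).conv,
        ih h.2 (red_scons hu hσ) hus⟩

theorem kArgs_subst (K : Kd C F) (ρ σ : ℕ → Obj C F) (us : List (Obj C F)) :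
    KArgs S R (K.subst ρ) σ us = KArgs S R K (fun n => (ρ n).subst σ) us := by
  induction K generalizing ρ σ us with
  | type => cases us <;> rfl
  | pi U K ih =>
    cases us with
    | nil => rfl
    | cons u us => simp only [Kd.subst, KArgs, subst_subst, ih, scons_subst_scons]

theorem kArgs_inst (K : Kd C F) (u : Obj C F) (σ : ℕ → Obj C F) (us : List (Obj C F)) :
    KArgs S R (K.inst u) σ us = KArgs S R K (scons (u.subst σ) σ) us := by
  simp only [Kd.inst, kArgs_subst, single_eq_scons, scons_comp, Term.subst]

theorem kArgs_eq_of_closed {K : Kd C F} (h : ∀ σ, K.subst σ = K) (σ ρ : ℕ → Obj C F)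
    (us : List (Obj C F)) : KArgs S R K σ us = KArgs S R K ρ us := by
  have key : ∀ σ, KArgs S R K σ us = KArgs S R K .var us := by
    intro σ
    conv_rhs => rw [← h σ, kArgs_subst]
    simp only [subst_var]
  rw [key σ, key ρ]

/-- Unfolding the leading products of `T` passes from fully applied symbols, which `callComp`
treats, to the bare symbol. -/
theorem Interp.of_args (hconf : ∀ l : Lvl, IsConfluent (Step R (l := l))) {T : Ty C F}
    {P : Obj C F → Prop} {t : Obj C F} (hP : Interp R T P)
    (h : ∀ us B, us.length = T.arity → Args S R T us B → Comp S R B (apps t us)) : P t := by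
  induction hn : T.arity generalizing T P t with
  | zero => exact (hP.comp_iff (S := S) hconf).1 (h [] T hn.symm (.nil _))
  | succ n ih =>
    obtain ⟨U, V, rfl⟩ := eq_pi_of_arity_pos T (by omega)
    obtain ⟨P', Q, hP', hQ, rfl⟩ := hP.pi_inv hconf
    intro u hu
    refine ih (hQ u hu) (fun us B hl hB => ?_) (by rw [arity_inst]; simpa [Term.arity] using hn)
    refine h (u :: us) B ?_ (.cons (.interp hP' hu) hB)
    rw [arity_inst] at hl
    simp only [List.length_cons, hl, Term.arity]

theorem kComp_of_kArgs {K : Kd C F} {σ : ℕ → Obj C F} {T : Ty C F}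
    (h : ∀ us, KArgs S R K σ us → KComp S R .type .var (apps T us)) : KComp S R K σ T := by
  induction K generalizing σ T with
  | type => exact h [] trivial
  | pi U K ih => exact fun u hu => ih fun us hus => h (u :: us) ⟨hu, hus⟩

/-! ### Variables of left-hand sides -/

/-- Argument types of constructors are data types, whose instances are never convertible to a
product and so are interpreted by all strongly normalizing objects. Normalization of the matched
argument is therefore enough, without a positivity condition. -/
theorem AccTy.comp_of_isCtorType (hconf : ∀ l : Lvl, IsConfluent (Step R (l := l)))
    {T A : Ty C F} {qs : List (Obj C F)} {x : ℕ} {σ : ℕ → Obj C F} (h : AccTy S T qs x A)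
    (hT : S.IsCtorType T) (hqs : ∀ q ∈ qs, SN R (q.subst σ)) : Comp S R (A.subst σ) (σ x) := by
  have inv : ∀ {A B : Ty C F}, S.IsCtorType (.pi A B) → S.IsData A ∧ S.IsCtorType B := by
    intro A B h
    cases h with
    | data h => exact h.conHeaded.elim
    | arrow h₁ h₂ => exact ⟨h₁, h₂⟩
  induction h with
  | @here A B x ps =>
    exact .interp (.base fun _ _ => ((inv hT).1.subst σ).conHeaded.not_conv_pi hconf)
      (hqs (.var x) (by simp))
  | @inside A B T x c qs ps hc _ _ ih =>
    refine ih hc fun q hq => ?_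
    have := hqs _ (List.mem_cons_self ..)
    rw [apps_subst] at this
    exact this.of_apps.2 _ (List.mem_map_of_mem hq)
  | there _ ih => exact ih ((inv hT).2.subst _) fun q hq => hqs q (by simp [hq])

theorem AccTy.comp (hR : S.IsRewriteSystem R)
    (hconf : ∀ l : Lvl, IsConfluent (Step R (l := l)))
    {T A B : Ty C F} {ps : List (Obj C F)} {x : ℕ} {σ : ℕ → Obj C F} (h : AccTy S T ps x A)
    (hps : Args S R (T.subst σ) (ps.map (Term.subst σ)) B) : Comp S R (A.subst σ) (σ x) := by
  induction h with
  | here =>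
    simp only [Term.subst, List.map_cons] at hps
    cases hps with
    | cons hu _ => exact hu
  | inside hc _ h _ =>
    refine h.comp_of_isCtorType hconf hc fun q hq => ?_
    have := hps.sn hR hconf _ (List.mem_map_of_mem (List.mem_cons_self ..))
    rw [apps_subst] at this
    exact this.of_apps.2 _ (List.mem_map_of_mem hq)
  | there _ ih =>
    simp only [Term.subst, List.map_cons] at hps
    cases hps with
    | cons _ h => rw [← inst_subst_comm] at h; exact ih h

theorem AccKd.comp (hR : S.IsRewriteSystem R)
    (hconf : ∀ l : Lvl, IsConfluent (Step R (l := l)))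
    {K : Kd C F} {A : Ty C F} {ps : List (Obj C F)} {x : ℕ} {σ : ℕ → Obj C F}
    (h : AccKd S K ps x A) (hps : KArgs S R K σ (ps.map (Term.subst σ))) :
    Comp S R (A.subst σ) (σ x) := by
  induction h with
  | here => exact hps.1
  | inside hc _ h =>
    refine h.comp_of_isCtorType hconf hc fun q hq => ?_
    have := hps.sn hR hconf _ (List.mem_map_of_mem (List.mem_cons_self ..))
    rw [apps_subst] at this
    exact this.of_apps.2 _ (List.mem_map_of_mem hq)
  | there _ ih => exact ih (by rw [kArgs_inst]; exact hps.2)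

/-! ### Soundness of the computability closure -/

/-- A call with computable arguments, of a symbol with a well-formed type or kind, is computable. -/
def CallComp (S : Sig C F) (R : Rules C F) : Sym F → List (Obj C F) → Prop
  | ⟨.obj, f⟩, ts => Deriv S R (.ty [] (S.objFn f) .type) → ts.length = S.arity ⟨.obj, f⟩ →
      ∀ B, Args S R (S.objFn f) ts B → Comp S R B (apps (.fn f) ts)
  | ⟨.ty, f⟩, ts => Deriv S R (.kind [] (S.tyFn f)) → KArgs S R (S.tyFn f) .var ts →
      KComp S R .type .var (apps (.fn f) ts)

/-- `ρ` extends the instance `σ` of a left-hand side by computable objects for `Γ`. -/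
def Env (S : Sig C F) (R : Rules C F) (σ : ℕ → Obj C F) (Γ : List (Ty C F))
    (ρ : ℕ → Obj C F) : Prop :=
  (∀ n, ρ (n + Γ.length) = σ n) ∧
    ∀ n A, Γ[n]? = some A → Comp S R ((A.shift (n + 1)).subst ρ) (ρ n)

theorem shift_succ_subst_scons {l : Lvl} (t : Term C F l) (k : ℕ) (u : Obj C F)
    (σ : ℕ → Obj C F) : (t.shift (k + 1)).subst (scons u σ) = (t.shift k).subst σ := by
  simp only [shift_subst]; rfl

theorem shift_zero {l : Lvl} (t : Term C F l) : t.shift 0 = t := by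
  rw [Term.shift, rename_eq_subst]; exact subst_var t

theorem Env.cons {σ ρ : ℕ → Obj C F} {Γ : List (Ty C F)} (h : Env S R σ Γ ρ) {U : Ty C F}
    {u : Obj C F} (hu : Comp S R (U.subst ρ) u) : Env S R σ (U :: Γ) (scons u ρ) := by
  refine ⟨fun n => h.1 n, fun n A hA => ?_⟩
  rw [shift_succ_subst_scons]
  cases n with
  | zero =>
    obtain rfl : U = A := by simpa using hA
    rw [shift_zero]
    exact hu
  | succ n => exact h.2 n A (by simpa using hA)

/-- Semantic validity of the judgments of the computability closure. -/
def CJudg.Valid (S : Sig C F) (R : Rules C F) (σ : ℕ → Obj C F) : CJudg C F → Prop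
  | .obj Γ t A => ∀ ρ, Env S R σ Γ ρ → Comp S R (A.subst ρ) (t.subst ρ)
  | .ty Γ T K => ∀ ρ, Env S R σ Γ ρ → KComp S R K ρ (T.subst ρ)
  | .tyArgs Γ A us B => ∀ ρ, Env S R σ Γ ρ →
      Args S R (A.subst ρ) (us.map (Term.subst ρ)) (B.subst ρ)
  | .kdArgs Γ K us K' => us.length = K.arity → K' = .type ∧
      ∀ ρ, Env S R σ Γ ρ → KArgs S R K ρ (us.map (Term.subst ρ))

theorem interpretable_pi {U T : Ty C F} {P : Obj C F → Prop} (hU : Interp R U P)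
    (hT : ∀ u, P u → Interpretable R (T.inst u)) : Interpretable R (.pi U T) := by
  choose! Q hQ using hT
  exact ⟨_, .pi (.refl _) hU hQ⟩

theorem kComp_pi (hR : S.IsRewriteSystem R)
    (hconf : ∀ l : Lvl, IsConfluent (Step R (l := l))) {U T : Ty C F} {ρ : ℕ → Obj C F}
    (hU : KComp S R .type ρ (U.subst ρ))
    (hT : ∀ u, Comp S R (U.subst ρ) u → KComp S R .type (scons u ρ) (T.subst (scons u ρ))) :
    KComp S R .type ρ ((Term.pi U T).subst ρ) := by
  obtain ⟨hsn, P, hP⟩ := hU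
  have hv := hT _ ((isCand_comp hR hconf _).var 0)
  refine ⟨hsn.pi (SN.of_subst (σ := single (.var 0)) ?_), interpretable_pi hP fun u hu => ?_⟩
  · have := hv.1
    rwa [← subst_liftSub_inst] at this
  · rw [subst_liftSub_inst]
    exact (hT u (.interp hP hu)).2

theorem kComp_lam (hR : S.IsRewriteSystem R)
    (hconf : ∀ l : Lvl, IsConfluent (Step R (l := l))) {U T : Ty C F} {K : Kd C F}
    {ρ : ℕ → Obj C F} (hU : KComp S R .type ρ (U.subst ρ))
    (hT : ∀ u, Comp S R (U.subst ρ) u → KComp S R K (scons u ρ) (T.subst (scons u ρ))) :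
    KComp S R (.pi U K) ρ ((Term.lam U T).subst ρ) := by
  have hc := isCand_comp hR hconf (U.subst ρ)
  have hv := (isCand_kComp hR hconf _ _).sn (hT _ (hc.var 0))
  rw [← subst_liftSub_inst] at hv
  intro u hu
  refine (isCand_kComp hR hconf _ _).beta hR hU.1 hv.of_subst (hc.sn hu) ?_
  rw [subst_liftSub_inst]
  exact hT u hu

/-- Symbols enter the closure only through calls, which `hcall` covers; each other rule is matched
by a closure property of `Comp` or `KComp`. No type needs to be known interpretable beforehand. -/
theorem CC.valid (hR : S.IsRewriteSystem R)
    (hconf : ∀ l : Lvl, IsConfluent (Step R (l := l))) {f : Sym F} {ps : List (Obj C F)}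
    {σ : ℕ → Obj C F} (hvar : ∀ x A, S.LhsVar f ps x A → Comp S R (A.subst σ) (σ x))
    (hcall : ∀ k g us ρ, Call S R f ps k g us → (∀ n, ρ (n + k) = σ n) →
      (∀ v ∈ us.map (Term.subst ρ), SN R v) → CallComp S R g (us.map (Term.subst ρ)))
    {J : CJudg C F} (h : CC S R f ps J) : J.Valid S R σ := by
  induction h with
  | @lhsVar Γ x A h =>
    intro ρ hρ
    rw [shift_subst]
    simp only [Term.subst, hρ.1]
    exact hvar x A h
  | boundVar h => exact fun ρ hρ => hρ.2 _ _ h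
  | @objCall Γ g us B hc hτ _ ih =>
    intro ρ hρ
    have ha := ih ρ hρ
    rw [hτ.subst_eq_of_ty] at ha
    rw [apps_subst]
    obtain ⟨_, _, hl, _⟩ := id hc
    exact hcall _ _ _ ρ hc hρ.1 (ha.sn hR hconf) hτ (by simpa using hl) _ ha
  | @tyCall Γ g us K hc hτ _ ih =>
    intro ρ hρ
    obtain ⟨_, _, hl, _⟩ := id hc
    -- As many arguments as the kind has arrows leave the kind `Type`.
    obtain ⟨rfl, ha⟩ := ih hl
    have ha := ha ρ hρ
    rw [apps_subst]
    refine hcall _ _ _ ρ hc hρ.1 (ha.sn hR hconf) hτ ?_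
    rwa [kArgs_eq_of_closed hτ.subst_eq_of_kind _ ρ]
  | tyArgsNil => exact fun ρ _ => .nil _
  | tyArgsCons _ _ ih₁ ih₂ =>
    intro ρ hρ
    refine .cons (ih₁ ρ hρ) ?_
    have := ih₂ ρ hρ
    rwa [inst_subst_comm] at this
  | @kdArgsNil Γ K =>
    intro hl
    cases K with
    | type => exact ⟨rfl, fun _ _ => trivial⟩
    | pi U K => cases hl
  | kdArgsCons _ _ ih₁ ih₂ =>
    intro hl
    obtain ⟨rfl, h₂⟩ := ih₂ (by simpa [Kd.inst, kd_arity_subst, Kd.arity] using hl)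
    refine ⟨rfl, fun ρ hρ => ⟨ih₁ ρ hρ, ?_⟩⟩
    have := h₂ ρ hρ
    rwa [kArgs_inst] at this
  | tyCon D _ =>
    exact fun ρ _ => kComp_of_conHeaded hR hconf _ _ (by simp only [Term.subst, Term.ConHeaded])
      ⟨_, fun _ h => (not_step_con h).elim⟩
  | tyPi _ _ ih₁ ih₂ =>
    exact fun ρ hρ => kComp_pi hR hconf (ih₁ ρ hρ) fun u hu => ih₂ _ (hρ.cons hu)
  | tyLam _ _ ih₁ ih₂ =>
    exact fun ρ hρ => kComp_lam hR hconf (ih₁ ρ hρ) fun u hu => ih₂ _ (hρ.cons hu)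
  | tyApp _ _ ih₁ ih₂ =>
    intro ρ hρ
    rw [kComp_inst]
    exact ih₁ ρ hρ _ (ih₂ ρ hρ)
  | tyConv _ hc ih =>
    intro ρ hρ
    rw [← kComp_eq_of_conv hc]
    exact ih ρ hρ
  | objLam _ _ ih₁ ih₂ =>
    intro ρ hρ
    obtain ⟨hsn, P, hP⟩ := ih₁ ρ hρ
    refine Comp.lam hR hconf hsn hP fun u hu => ?_
    rw [subst_liftSub_inst, subst_liftSub_inst]
    exact ih₂ _ (hρ.cons (.interp hP hu))
  | objApp _ _ ih₁ ih₂ =>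
    intro ρ hρ
    rw [inst_subst_comm]
    exact (ih₁ ρ hρ).app hR hconf (ih₂ ρ hρ)
  | objConv _ hc ih => exact fun ρ hρ => (ih ρ hρ).conv (Conv.subst hc ρ)

theorem forall₂_red_trans {us vs ws : List (Obj C F)} (h : List.Forall₂ (Red R) us vs)
    (h' : List.Forall₂ (Red R) vs ws) : List.Forall₂ (Red R) us ws := by
  induction h generalizing ws with
  | nil => exact h'
  | cons h _ ih =>
    cases h' with
    | cons h₁ h₂ => exact .cons (h.trans h₁) (ih h₂)

/-- Every call with computable arguments is computable. -/
theorem callComp (hR : S.IsRewriteSystem R) (hfin : (Defined R).Finite)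
    (hconf : ∀ l : Lvl, IsConfluent (Step R (l := l))) (hCC : SatisfiesCC S R)
    (hSCT : SizeChangeTerminating S R) (x : Sym F × List (Obj C F)) (hx : ∀ v ∈ x.2, SN R v) :
    CallComp S R x.1 x.2 := by
  induction acc_callRel hfin hSCT x hx with
  | intro x _ ih =>
    have ih' : ∀ ps σ, List.Forall₂ (Red R) x.2 (ps.map (Term.subst σ)) → ∀ k g us ρ,
        Call S R x.1 ps k g us → (∀ n, ρ (n + k) = σ n) →
        (∀ v ∈ us.map (Term.subst ρ), SN R v) → CallComp S R g (us.map (Term.subst ρ)) :=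
      fun ps σ hps k g us ρ hc hρ hsn =>
        ih (g, us.map (Term.subst ρ)) ⟨ps, k, us, σ, ρ, hps, hc, hρ, rfl, hsn⟩ hsn
    have henv : ∀ σ : ℕ → Obj C F, Env S R σ [] σ := fun σ => ⟨fun _ => rfl, by simp⟩
    obtain ⟨⟨l, f⟩, ts⟩ := x
    have hrefl : List.Forall₂ (Red R) ts ts := List.forall₂_same.2 fun _ _ => .refl
    cases l with
    | obj =>
      intro hτ hl B hB
      -- The inner induction runs over reducts of `ts`, while the outer hypothesis stays attached to
      -- `ts`: `CallRel` allows reductions before matching.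
      suffices H : ∀ us, List.Forall₂ (Red R) ts us → Comp S R B (apps (.fn f) us) from
        H ts hrefl
      intro us hus
      have hlus : us.length = S.arity ⟨.obj, f⟩ := by rw [← hus.length_eq]; exact hl
      have hargs : ∃ B', Args S R (S.objFn f) us B' ∧ Conv R B B' :=
        hB.red hR hconf (.refl _) hl.le hus
      have hacc : Acc (fun x y => ListStep R y x) us := by
        obtain ⟨B', hB', _⟩ := hargs
        exact acc_listStep (hB'.sn hR hconf)
      induction hacc with
      | intro us _ ihus =>
        -- A fully applied symbol is neutral, so it is enough to treat a rule step at the root and a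
        -- step in one argument.
        refine (isCand_comp hR hconf B).neutral (neutral_apps_fn f hlus.ge) fun s hs => ?_
        rcases step_apps_fn_inv hR hlus.le hs with ⟨ps, r, σ, hr, rfl, rfl⟩ | ⟨us', hus', rfl⟩
        · obtain ⟨B', hB', hc⟩ := hargs
          rw [← hτ.subst_eq_of_ty σ] at hB'
          obtain rfl := hB'.eq_resultTy
          -- The right-hand side has the result type computed from the reduced arguments, which is
          -- only convertible to `B`.
          refine Comp.conv ?_ hc.symm
          exact CC.valid (f := ⟨.obj, f⟩) hR hconf (fun x A h => AccTy.comp hR hconf h hB')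
            (ih' ps σ hus) (hCC.1 f ps r hr) σ (henv σ)
        · have h₁ := forall₂_red_trans hus hus'.red
          exact ihus us' hus' h₁ (by rw [← h₁.length_eq]; exact hl)
            (hB.red hR hconf (.refl _) hl.le h₁)
    | ty =>
      intro hτ hts
      suffices H : ∀ us, List.Forall₂ (Red R) ts us → KComp S R .type .var (apps (.fn f) us) from
        H ts hrefl
      intro us hus
      have hargs : KArgs S R (S.tyFn f) .var us := hts.red hR hconf (fun _ => .refl) hus
      have hacc : Acc (fun x y => ListStep R y x) us := acc_listStep (hargs.sn hR hconf)
      induction hacc with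
      | intro us _ ihus =>
        have hlus : us.length = S.arity ⟨.ty, f⟩ := hargs.length_eq
        refine (isCand_kComp hR hconf .type .var).neutral (neutral_apps_fn f hlus.ge)
          fun s hs => ?_
        rcases step_apps_fn_inv hR hlus.le hs with ⟨ps, r, σ, hr, rfl, rfl⟩ | ⟨us', hus', rfl⟩
        · rw [kArgs_eq_of_closed hτ.subst_eq_of_kind _ σ] at hargs
          exact CC.valid (f := ⟨.ty, f⟩) hR hconf (fun x A h => AccKd.comp hR hconf h hargs)
            (ih' ps σ hus) (hCC.2 f ps r hr) σ (henv σ)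
        · exact ihus us' hus' (forall₂_red_trans hus hus'.red)
            (hargs.red hR hconf (fun _ => .refl) hus'.red)

/-! ### Typable terms are computable -/

/-- `σ` maps the variables of `Γ` to objects in the interpretation of their type. -/
def InterpEnv (R : Rules C F) (Γ : List (Ty C F)) (σ : ℕ → Obj C F) : Prop :=
  ∀ n A, Γ[n]? = some A → ∃ P, Interp R ((A.shift (n + 1)).subst σ) P ∧ P (σ n)

theorem InterpEnv.cons {σ : ℕ → Obj C F} {Γ : List (Ty C F)} (h : InterpEnv R Γ σ) {U : Ty C F}
    {P : Obj C F → Prop} {u : Obj C F} (hP : Interp R (U.subst σ) P) (hu : P u) :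
    InterpEnv R (U :: Γ) (scons u σ) := by
  intro n A hA
  rw [shift_succ_subst_scons]
  cases n with
  | zero =>
    obtain rfl : U = A := by simpa using hA
    rw [shift_zero]
    exact ⟨P, hP, hu⟩
  | succ n => exact h n A (by simpa using hA)

/-- The weakenings of the identity are valid environments for `Γ`. -/
def CtxOk (R : Rules C F) (Γ : List (Ty C F)) : Prop :=
  ∀ k, InterpEnv R Γ (fun n => .var (n + k))

/-- The domains in the kind `K` are computable under the substitution `σ`. -/
def KindOk (R : Rules C F) : Kd C F → (ℕ → Obj C F) → Prop
  | .type, _ => True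
  | .pi U K, σ => SN R (U.subst σ) ∧
      ∃ P, Interp R (U.subst σ) P ∧ ∀ u, P u → KindOk R K (scons u σ)

theorem KindOk.terminates (hR : S.IsRewriteSystem R)
    (hconf : ∀ l : Lvl, IsConfluent (Step R (l := l))) {K : Kd C F} {σ : ℕ → Obj C F}
    (h : KindOk R K σ) : Terminates (KStep R) K := by
  induction K generalizing σ with
  | type => exact ⟨_, fun _ h => by cases h⟩
  | pi U K ih =>
    obtain ⟨hU, P, hP, hK⟩ := h
    have hK' := ih (hK _ ((hP.isCand hR hconf).var 0))
    have hU' : SN R U := hU.of_subst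
    clear ih hK hP hU
    induction hU' generalizing K with
    | intro U hU ihU =>
      induction hK' with
      | intro K hK ihK =>
        refine ⟨_, fun s hs => ?_⟩
        cases hs with
        | piDom _ h => exact ihU _ h _ ⟨_, hK⟩
        | piCod _ h => exact ihK _ h

/-- Semantic validity of typing judgments. -/
def Judg.Valid (S : Sig C F) (R : Rules C F) : Judg C F → Prop
  | .ctx Γ => CtxOk R Γ
  | .kind Γ K => CtxOk R Γ ∧ ∀ σ, InterpEnv R Γ σ → KindOk R K σ
  | .ty Γ T K => CtxOk R Γ ∧ ∀ σ, InterpEnv R Γ σ → KComp S R K σ (T.subst σ)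
  | .obj Γ t A => CtxOk R Γ ∧
      ∀ σ, InterpEnv R Γ σ → ∃ P, Interp R (A.subst σ) P ∧ P (t.subst σ)

/-- Since `callComp` presupposes no interpretation of the declared types, these can now be
interpreted by induction on their own typing derivations. -/
theorem Deriv.valid (hR : S.IsRewriteSystem R) (hfin : (Defined R).Finite)
    (hconf : ∀ l : Lvl, IsConfluent (Step R (l := l))) (hCC : SatisfiesCC S R)
    (hSCT : SizeChangeTerminating S R) {J : Judg C F} (h : Deriv S R J) : J.Valid S R := by
  induction h with
  | ctxNil => exact fun k n A h => by simp at h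
  | @ctxCons Γ A _ _ ih₁ ih₂ =>
    intro k n B hB
    rw [shift_subst]
    -- Adding a variable shifts the older ones once more; for this reason `CtxOk` ranges over all
    -- weakenings.
    have hΓ := ih₁ (k + 1)
    cases n with
    | zero =>
      obtain rfl : A = B := by simpa using hB
      obtain ⟨_, P, hP⟩ := ih₂.2 _ hΓ
      refine ⟨P, ?_, (hP.isCand hR hconf).var _⟩
      convert hP using 3
      simp only [Term.var.injEq]
      omega
    | succ n =>
      obtain ⟨P, hP, hv⟩ := hΓ n B (by simpa using hB)
      rw [shift_subst] at hP
      refine ⟨P, ?_, (hP.isCand hR hconf).var _⟩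
      convert hP using 3
      simp only [Term.var.injEq]
      omega
  | kindType _ ih => exact ⟨ih, fun _ _ => trivial⟩
  | kindPi _ _ ih₁ ih₂ =>
    refine ⟨ih₁.1, fun σ hσ => ?_⟩
    obtain ⟨hsn, P, hP⟩ := ih₁.2 σ hσ
    exact ⟨hsn, P, hP, fun u hu => ih₂.2 _ (hσ.cons hP hu)⟩
  | tyCon D _ _ ih _ =>
    exact ⟨ih, fun σ _ => kComp_of_conHeaded hR hconf _ _
      (by simp only [Term.subst, Term.ConHeaded]) ⟨_, fun _ h => (not_step_con h).elim⟩⟩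
  | tyFn f _ hτ ih _ =>
    refine ⟨ih, fun σ _ => kComp_of_kArgs fun us hus => ?_⟩
    rw [kArgs_eq_of_closed hτ.subst_eq_of_kind _ .var] at hus
    exact callComp hR hfin hconf hCC hSCT (⟨.ty, f⟩, us) (hus.sn hR hconf) hτ hus
  | tyPi _ _ ih₁ ih₂ =>
    refine ⟨ih₁.1, fun σ hσ => ?_⟩
    obtain ⟨_, P, hP⟩ := ih₁.2 σ hσ
    exact kComp_pi hR hconf (ih₁.2 σ hσ) fun u hu =>
      ih₂.2 _ (hσ.cons hP ((hP.comp_iff hconf).1 hu))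
  | tyLam _ _ ih₁ ih₂ =>
    refine ⟨ih₁.1, fun σ hσ => ?_⟩
    obtain ⟨_, P, hP⟩ := ih₁.2 σ hσ
    exact kComp_lam hR hconf (ih₁.2 σ hσ) fun u hu =>
      ih₂.2 _ (hσ.cons hP ((hP.comp_iff hconf).1 hu))
  | tyApp _ _ ih₁ ih₂ =>
    refine ⟨ih₁.1, fun σ hσ => ?_⟩
    obtain ⟨P, hP, hu⟩ := ih₂.2 σ hσ
    rw [kComp_inst]
    exact ih₁.2 σ hσ _ (.interp hP hu)
  | tyConv _ _ _ hc ih =>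
    refine ⟨ih.1, fun σ hσ => ?_⟩
    rw [← kComp_eq_of_conv hc]
    exact ih.2 σ hσ
  | objVar _ h ih => exact ⟨ih, fun σ hσ => hσ _ _ h⟩
  | objFn f _ hτ ih ihτ =>
    refine ⟨ih, fun σ _ => ?_⟩
    -- The declared type is typed in the empty context, where every substitution is a valid
    -- environment.
    obtain ⟨_, P, hP⟩ := ihτ.2 σ fun n A h => by simp at h
    rw [hτ.subst_eq_of_ty] at hP ⊢
    refine ⟨P, hP, hP.of_args (S := S) hconf fun us B hl hB => ?_⟩
    exact callComp hR hfin hconf hCC hSCT (⟨.obj, f⟩, us) (hB.sn hR hconf) hτ hl B hB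
  | @objLam Γ U B t _ _ ih₁ ih₂ =>
    refine ⟨ih₁.1, fun σ hσ => ?_⟩
    obtain ⟨hsn, P, hP⟩ := ih₁.2 σ hσ
    have hbody : ∀ u, P u → ∃ Q, Interp R ((B.subst (liftSub σ)).inst u) Q ∧
        Q ((t.subst (liftSub σ)).inst u) := by
      intro u hu
      rw [subst_liftSub_inst, subst_liftSub_inst]
      exact ih₂.2 _ (hσ.cons hP hu)
    -- The body, at each computable argument, supplies the interpretation of the codomain, and
    -- thereby that of the product.
    obtain ⟨X, hX⟩ := interpretable_pi hP fun u hu => (hbody u hu).imp fun _ h => h.1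
    refine ⟨X, hX, (hX.comp_iff (S := S) hconf).1 (Comp.lam hR hconf hsn hP fun u hu => ?_)⟩
    obtain ⟨Q, hQ, h⟩ := hbody u hu
    exact .interp hQ h
  | objApp _ _ ih₁ ih₂ =>
    refine ⟨ih₁.1, fun σ hσ => ?_⟩
    obtain ⟨X, hX, ht⟩ := ih₁.2 σ hσ
    obtain ⟨P, hP, hu⟩ := ih₂.2 σ hσ
    obtain ⟨P', Q, hP', hQ, rfl⟩ := hX.pi_inv hconf
    obtain rfl := hP.unique hconf hP' (.refl _)
    rw [inst_subst_comm]
    exact ⟨_, hQ _ hu, ht _ hu⟩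
  | objConv _ _ _ hc ih =>
    refine ⟨ih.1, fun σ hσ => ?_⟩
    obtain ⟨P, hP, ht⟩ := ih.2 σ hσ
    exact ⟨P, hP.conv (Conv.subst hc σ), ht⟩

end LambdaPi

/-! ### Strong normalization of typable terms -/

open LambdaPi
theorem mainTheorem1 {C : Type u} {F : Lvl → Type v} (S : Sig C F) (R : Rules C F)
    (hR : S.IsRewriteSystem R)
    (hfin : (Defined R).Finite)
    (hconf : ∀ l : Lvl, IsConfluent (Step R (l := l)))
    (hpres : PreservesTyping S R)
    (hCC : SatisfiesCC S R)
    (hSCT : SizeChangeTerminating S R) :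
    (∀ (Γ : List (Ty C F)) (t : Obj C F) (A : Ty C F),
      Deriv S R (.obj Γ t A) → Terminates (Step R) t) ∧
    (∀ (Γ : List (Ty C F)) (T : Ty C F) (K : Kd C F),
      Deriv S R (.ty Γ T K) → Terminates (Step R) T) ∧
    (∀ (Γ : List (Ty C F)) (K : Kd C F),
      Deriv S R (.kind Γ K) → Terminates (KStep R) K) := by
  refine ⟨fun Γ t A h => ?_, fun Γ T K h => ?_, fun Γ K h => ?_⟩
  · obtain ⟨hΓ, h⟩ := h.valid hR hfin hconf hCC hSCT
    -- The weakening by 0 is the identity, a valid environment because candidates contain the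
    -- variables.
    obtain ⟨P, hP, ht⟩ := h _ (hΓ 0)
    exact ((hP.isCand hR hconf).sn ht).of_subst
  · obtain ⟨hΓ, h⟩ := h.valid hR hfin hconf hCC hSCT
    exact ((isCand_kComp hR hconf _ _).sn (h _ (hΓ 0))).of_subst
  · obtain ⟨hΓ, h⟩ := h.valid hR hfin hconf hCC hSCT
    exact (h _ (hΓ 0)).terminates hR hconf
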